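/- Let $R$ be a reduced irreducible (crystallographic) root system of type $B_n$ or $D_{n+1}$ with $n\ge 3$, with a chosen base $\Delta$, positive roots $R^+$, Weyl group $W$ and height function $\mathrm{ht}$. Realize $R$ in the standard way, with simple roots $\alpha_i=\varepsilon_i-\varepsilon_{i-1}$ $(2\le i\le n)$ and $\alpha_1=\varepsilon_1$ in type $B_n$, resp. $\alpha_i=\varepsilon_i-\varepsilon_{i-1}$ $(1\le i\le n)$ and $\alpha_0=\varepsilon_1+\varepsilon_0$ in type $D_{n+1}$. For an integer $1\le m\le n$ let $R(m)$ be the root subsystem of all roots whose height is a multiple of $m$, $R^+(m)=R(m)\cap R^+$, $\Gamma(m)$ the set of simple roots of $R(m)$ with respect to $R^+(m)$ (the elements of $R^+(m)$ that are not sums of two elements of $R^+(m)$), and $R_m$ the set of roots of height $m$. Let $$d_m=\prod_{\beta\in R^+(m)}\frac{\langle \rho/m,\beta\rangle}{\langle\rho_m,\beta\rangle},$$ where $\rho$ and $\rho_m$ are the half-sums of the coroots $\beta^\vee$ of the $\beta\in R^+$ and of the $\beta\in R^+(m)$, respectively. A root subsystem of $R$ is of Levi type if it is $W$-conjugate to the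 root subsystem generated by a subset of $\Delta$. Write $n=qm+t$ with $0\le t\le m-1$, and set $k=\lfloor m/2\rfloor$. Denote by $BD_q$ the diagram $B_q$ if $R=B_n$ and $D_{q+1}$ if $R=D_{n+1}$ (with $B_1=A_1$, $D_2=2A_1$, $D_3=A_3$, $A_0=\varnothing$). Then: (a) If $m=2k+1$, then $R(m)$ is of Levi type and has type $$BD_q+\begin{cases} iA_{2q+1}+(k-i)A_{2q} & \text{if } t=k+i \text{ with } i=1,\dots,k,\\ tA_{2q}+(k-t)A_{2q-1} & \text{if } t=0,\dots,k.\end{cases}$$ (b) If $m=2k$ and $n=m+t$ with $t=0,\dots,k-1$ (that is, $m\le n<3k$), then $R(m)$ is of Levi type and has type $BD_1+tA_2+(k-1-t)A_1$. (c) If $m=2k$ and $n\ge 3k$, then $R(m)$ is not of Levi type. In this case set $p=q$ if $t\ge k$, and $p=q-1$ if $t<k$ (then $q\ge 2$). Then $\Gamma(m)=R_m\cup\{\delta\}$, where $\delta=\varepsilon_k+\varepsilon_{3k}$ has height $2m$. Let $X^\dagger\subseteq\Gamma(m)$ consist of $\delta$ and the roots $\varepsilon_{k+cm}-\varepsilon_{k+(c-1)m}$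 for $c=1,\dots,p$. The roots of $X^\dagger$ are orthogonal to those of $\Gamma(m)\setminus X^\dagger$; for $p\ge 2$, $X^\dagger$ is the connected component of $\delta$ in the Dynkin diagram $\Gamma(m)$, and for $p=1$ it is the disconnected diagram $D_2=2A_1$. With $X^0=X^\dagger\setminus\{\delta\}$, and with the superscript $\dagger$ marking the part $X^\dagger$ of $\Gamma(m)$, one has $$\begin{array}{|c|c|c|c|}\hline & \Gamma(m) & X^0 & d_m\\ \hline t=k+i,\ i=0,\dots,k-1 & BD_q+(k-1-i)A_{2q}+iA_{2q+1}+D_{q+1}^\dagger & A_q & 2^q\\ \hline q\ge 2,\ t=0,\dots,k-1 & BD_q+tA_{2q}+(k-1-t)A_{2q-1}+D_q^\dagger & A_{q-1} & 2^{q-1}\\ \hline\end{array}$$ -/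

import Mathlib

namespace HeightSubsystem

open RootPairing

/-! ### Dynkin diagrams, encoded by Cartan matrices -/

/-- Disjoint union of two diagrams: the block diagonal Cartan matrix. -/
def diagramSum {κ κ' : Type} (A : Matrix κ κ ℤ) (B : Matrix κ' κ' ℤ) :
    Matrix (κ ⊕ κ') (κ ⊕ κ') ℤ :=
  Matrix.fromBlocks A 0 0 B

infixl:65 " ⊕ᴅ " => diagramSum

/-- Disjoint union of `c` copies of a diagram. -/
def copies {κ : Type} (c : ℕ) (A : Matrix κ κ ℤ) : Matrix (κ × Fin c) (κ × Fin c) ℤ :=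
  Matrix.blockDiagonal fun _ : Fin c => A

/-- The diagram of type `A_r` (with `A_0` empty); here `CartanMatrix.A r` has size `r`. -/
abbrev typeA (r : ℕ) : Matrix (Fin r) (Fin r) ℤ := CartanMatrix.A r

/-- The diagram of type `D_r`; in particular `D_2 = 2 A_1` and `D_3 = A_3`. -/
abbrev typeD (r : ℕ) : Matrix (Fin r) (Fin r) ℤ := CartanMatrix.D r

/-- The two families under consideration: `B_n` and `D_{n+1}`. -/
inductive Family : Type
  | B : Family
  | D : Family

/-- The rank of `B_n`, resp. `D_{n+1}`. -/
def Family.rank : Family → ℕ → ℕ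
  | .B, n => n
  | .D, n => n + 1

/-- The Cartan matrix `⟨α_i, α_j^∨⟩` of type `B_n`, resp. `D_{n+1}`: the diagram `BD_n`. -/
def Family.BD : (X : Family) → (n : ℕ) → Matrix (Fin (X.rank n)) (Fin (X.rank n)) ℤ
  | .B, n => CartanMatrix.B n
  | .D, n => CartanMatrix.D (n + 1)

/-! ### Sets of roots -/

section

variable {ι V N : Type*} [AddCommGroup V] [Module ℝ V] [AddCommGroup N] [Module ℝ N]
  (P : RootPairing ι ℝ V N)

/-- The set of roots `S` is a base of the set of roots `Q`. -/
def IsBaseOf (S Q : Set ι) : Prop :=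
  S ⊆ Q ∧ LinearIndepOn ℝ P.root S ∧
    ∀ i ∈ Q, P.root i ∈ AddSubmonoid.closure (P.root '' S) ∨
      -P.root i ∈ AddSubmonoid.closure (P.root '' S)

/-- The set of roots `S` has Dynkin diagram `A`. -/
def HasDiagram [P.IsCrystallographic] (S : Set ι) {κ : Type} (A : Matrix κ κ ℤ) : Prop :=
  ∃ f : κ ≃ S, ∀ x y : κ, P.pairingIn ℤ (f x) (f y) = A x y

/-- The root subsystem `Q` has type `A`: it has a base with Dynkin diagram `A`. -/
def HasType [P.IsCrystallographic] (Q : Set ι) {κ : Type} (A : Matrix κ κ ℤ) : Prop :=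
  ∃ S : Set ι, IsBaseOf P S Q ∧ HasDiagram P S A

/-- The root subsystem generated by a set `I` of roots: the smallest set of roots that
contains `I` and is stable under the reflections in its own elements. -/
def generatedSubsystem (I : Set ι) : Set ι :=
  ⋂₀ {S : Set ι | I ⊆ S ∧ ∀ i ∈ S, ∀ j ∈ S, P.reflectionPerm i j ∈ S}

/-- The connected component of `i` in the Dynkin diagram of `S` (for `i ∈ S`). -/
def component (S : Set ι) (i : ι) : Set ι :=
  {j | Relation.ReflTransGen (fun x y => y ∈ S ∧ P.pairing x y ≠ 0) i j}

variable {P}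
variable (b : P.Base)

/-- A set of roots is of Levi type if it is conjugate under the Weyl group to the root
subsystem generated by a set of simple roots. -/
def IsLeviType (Q : Set ι) : Prop :=
  ∃ w : P.weylGroup, ∃ I : Set ι, I ⊆ b.support ∧
    Q = P.weylGroupToPerm w '' generatedSubsystem P I

/-- `R(m)`: the roots whose height is a multiple of `m`. -/
def rootsMult (m : ℕ) : Set ι := {i | (m : ℤ) ∣ b.height i}

/-- `R⁺(m)`: the positive roots in `R(m)`. -/
def posRootsMult (m : ℕ) : Set ι := {i | i ∈ rootsMult b m ∧ b.IsPos i}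

/-- `R_m`: the roots of height `m`. -/
def rootsHeight (m : ℕ) : Set ι := {i | b.height i = m}

/-- `Γ(m)`: the simple roots of `R(m)` with respect to `R⁺(m)`, i.e. the elements of `R⁺(m)` that
are not the sum of two elements of `R⁺(m)`. -/
def simpleRootsMult (m : ℕ) : Set ι :=
  {i | i ∈ posRootsMult b m ∧
    ¬ ∃ j ∈ posRootsMult b m, ∃ l ∈ posRootsMult b m, P.root i = P.root j + P.root l}

open Classical in
/-- Half the sum of the coroots `β^∨` for `β` in a set `S` of roots. -/
noncomputable def halfSumCoroots [Fintype ι] (S : Set ι) : N :=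
  (1 / 2 : ℝ) • ∑ i with i ∈ S, P.coroot i

open Classical in
/-- The constant `d_m = ∏_{β ∈ R⁺(m)} ⟨ρ/m, β⟩ / ⟨ρ_m, β⟩`, where `ρ` and `ρ_m` are the half-sums of
the coroots of the elements of `R⁺` and of `R⁺(m)`. -/
noncomputable def dimConst [Fintype ι] (m : ℕ) : ℝ :=
  ∏ β with β ∈ posRootsMult b m,
    P.root' β ((1 / m : ℝ) • halfSumCoroots (P := P) {i | b.IsPos i}) /
      P.root' β (halfSumCoroots (P := P) (posRootsMult b m))

variable {b}

/-- The simple root `α_j` of `B_n` (`1 ≤ j ≤ n`), resp. `D_{n+1}` (`0 ≤ j ≤ n`), in the numbering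
`α_j = ε_j - ε_{j-1}` for `j ≥ 2` and
* `α_1 = ε_1` in type `B_n`;
* `α_1 = ε_1 - ε_0` and `α_0 = ε_1 + ε_0` in type `D_{n+1}`.

The order is the reverse of the one of the rows of the Cartan matrices in `Family.BD`, where `α_n`
comes first. The value outside the given range is `0`. -/
noncomputable def simpleRoot (X : Family) (n : ℕ) (e : Fin (X.rank n) ≃ b.support) (j : ℕ) : V :=
  if h : j ≤ n ∧ n - j < X.rank n then P.root (e ⟨n - j, h.2⟩) else 0

/-- The root `ε_k + ε_{3k}` of height `4k` in terms of the simple roots. -/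
noncomputable def deltaRoot (X : Family) (n : ℕ) (e : Fin (X.rank n) ≃ b.support) (k : ℕ) : V :=
  match X, e with
  | .B, e => 2 • ∑ j ∈ Finset.Icc 1 k, simpleRoot .B n e j +
      ∑ j ∈ Finset.Icc (k + 1) (3 * k), simpleRoot .B n e j
  | .D, e => simpleRoot .D n e 0 + simpleRoot .D n e 1 +
      2 • ∑ j ∈ Finset.Icc 2 k, simpleRoot .D n e j +
      ∑ j ∈ Finset.Icc (k + 1) (3 * k), simpleRoot .D n e j

/-- The roots `ε_{k+cm} - ε_{k+(c-1)m} = α_{k+(c-1)m+1} + ⋯ + α_{k+cm}`, for `c = 1, …, p`. -/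
def chainRoots (X : Family) (n : ℕ) (e : Fin (X.rank n) ≃ b.support) (m k p : ℕ) : Set ι :=
  {i | ∃ c : ℕ, 1 ≤ c ∧ c ≤ p ∧
    P.root i = ∑ j ∈ Finset.Icc (k + (c - 1) * m + 1) (k + c * m), simpleRoot X n e j}

/-- A row of the table for `m = 2k` and `n ≥ 3k`:
`Γ(m)` is the union of `R_m` and a root `δ = ε_k + ε_{3k}` of height `2m`, and has diagram
`rest + D_{p+1}^†`, where `X^† = D_{p+1}^†` consists of `δ` and of the roots
`ε_{k+cm} - ε_{k+(c-1)m}`, `c = 1, …, p`; moreover `X^0 = X^† - {δ}` has type `A_p` and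
`d_m = 2 ^ p`. If `p ≥ 2` then `X^†` is the connected component of `δ`; if `p = 1` it is the
disconnected diagram `D_2 = 2 A_1`. -/
def TableRow [Fintype ι] [P.IsCrystallographic] (X : Family) (n : ℕ)
    (e : Fin (X.rank n) ≃ b.support) (m k p : ℕ) {κ : Type} (rest : Matrix κ κ ℤ) : Prop :=
  ∃ δ : ι, P.root δ = deltaRoot X n e k ∧ b.height δ = 2 * m ∧
    simpleRootsMult b m = rootsHeight b m ∪ {δ} ∧
    IsBaseOf P (simpleRootsMult b m) (rootsMult b m) ∧
    HasDiagram P (simpleRootsMult b m) (rest ⊕ᴅ typeD (p + 1)) ∧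
    ∃ Xdag : Set ι, Xdag = chainRoots X n e m k p ∪ {δ} ∧
      Xdag ⊆ simpleRootsMult b m ∧
      (∀ i ∈ Xdag, ∀ j ∈ simpleRootsMult b m \ Xdag, P.IsOrthogonal i j) ∧
      (2 ≤ p → Xdag = component P (simpleRootsMult b m) δ) ∧
      HasDiagram P (simpleRootsMult b m \ Xdag) rest ∧
      HasDiagram P Xdag (typeD (p + 1)) ∧
      HasDiagram P (Xdag \ {δ}) (typeA p) ∧
      dimConst b m = 2 ^ p

end

end HeightSubsystem

open HeightSubsystem

/-! There are pairwise orthogonal vectors ε_0, …, ε_n, where ε_a has height a, the vectors ε_1, …,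
ε_n have length 1, and ε_0 is zero in type B and of length 1 in type D. The positive roots are ε_c ±
ε_a with a < c. With ε_{-a} = -ε_a for a > 0, a root is, up to a sign at ε_0, of the form ε_x - ε_y
with x, y in [-n, n] and |x| ≠ |y|, and its height is x - y. So it lies in R(m) exactly when x ≡ y
mod m, and R(m) splits orthogonally along the residue classes modulo m, taken up to sign. Class 0
gives BD_q. A class r with 0 < r < m/2 contains no two opposite integers and gives a diagram A_l,
where l + 1 is the number of its members in [-n, n]. For m = 2k the class of k is its own negative;
as soon as k + pm ≤ n with p ≥ 1 maximal, it gives D_{p+1}.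

Simple roots (`simpleRootsMult_cases`): from ε_x - ε_y of height greater than m one can split off a
root of height m at one of the two ends, unless both intermediate indices agree up to sign with an
end. This happens only for δ = ε_{3k} + ε_k. Any indecomposable set is a base
(`isBaseOf_simpleRootsMult`), so the type of R(m) is read off from the roots of height m and δ.

Levi type: a subsystem of Levi type contains all roots in its span, and conversely the zero set of a
coweight is of Levi type. If m is odd or n < 3k, then R(m) is the zero set of the coweight sending
ε_a to the balanced residue of a modulo m (`isLeviType_rootsMult`). If n ≥ 3k, the root ε_{2k} + ε_k
lies in the span of R(m) but not in R(m) (`not_isLeviType_rootsMult`).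

The constant d_m (`dimConst_eq`): ρ pairs with a positive root to its height, and ρ_m is determined
by taking the value 1 on Γ(m). The factor of β is therefore 1 except for β = ε_{k+cm} + ε_{k+dm},
where it is (c+d+1)/(c+d); the product of these telescopes to 2^p. -/

namespace HeightSubsystem

open RootPairing

/-! ### The height functional, the base Γ(m) of R(m), and half sums of coroots -/

section General

variable {ι V N : Type*} [AddCommGroup V] [Module ℝ V] [AddCommGroup N] [Module ℝ N]
  {P : RootPairing ι ℝ V N}

/-- The height as a linear functional. -/
noncomputable def heightFun [P.IsRootSystem] (b : P.Base) : V →ₗ[ℝ] ℝ :=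
  b.toWeightBasis.constr ℝ fun _ => (1 : ℝ)

lemma heightFun_simple [P.IsRootSystem] (b : P.Base) {i : ι} (hi : i ∈ b.support) :
    heightFun b (P.root i) = 1 := by
  have h := b.toWeightBasis.constr_basis ℝ (fun _ => (1 : ℝ)) ⟨i, hi⟩
  simpa [heightFun] using h

lemma heightFun_root [P.IsRootSystem] (b : P.Base) (i : ι) :
    heightFun b (P.root i) = b.height i := by
  obtain ⟨f, -, -, hf⟩ := b.exists_root_eq_sum_int i
  rw [Base.height_eq_sum hf, hf, map_sum, Int.cast_sum]
  refine Finset.sum_congr rfl fun j hj => ?_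
  rw [map_zsmul, heightFun_simple b hj]
  simp

lemma root_neg (i : ι) : P.root (P.reflectionPerm i i) = -P.root i := by simp

lemma height_neg (b : P.Base) (i : ι) : b.height (P.reflectionPerm i i) = -b.height i :=
  b.height_reflectionPerm_self i

lemma pairing_eq_pairingIn [P.IsCrystallographic] (i j : ι) :
    P.pairing i j = (P.pairingIn ℤ i j : ℝ) := by
  rw [← P.algebraMap_pairingIn ℤ]; simp

lemma height_reflectionPerm [P.IsCrystallographic] (b : P.Base) (i j : ι) :
    b.height (P.reflectionPerm j i) = b.height i - P.pairingIn ℤ i j * b.height j := by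
  have := P.reflection_apply_root' ℤ (i := j) (j := i)
  rw [← root_reflectionPerm, sub_eq_add_neg, ← neg_smul] at this
  rw [b.height_add_zsmul this]
  simp; ring

/-! ### The simple roots of `R(m)` -/

section SimpleRoots

variable [Finite ι] [P.IsRootSystem] [P.IsCrystallographic] (b : P.Base) (m : ℕ)

omit [Finite ι] [P.IsRootSystem] [P.IsCrystallographic] in
lemma neg_mem_rootsMult {i : ι} (hi : i ∈ rootsMult b m) :
    P.reflectionPerm i i ∈ rootsMult b m := by
  simpa [rootsMult, height_neg] using hi

omit [Finite ι] [P.IsRootSystem] [P.IsCrystallographic] in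
lemma posRootsMult_or_neg {i : ι} (hi : i ∈ rootsMult b m) :
    i ∈ posRootsMult b m ∨ P.reflectionPerm i i ∈ posRootsMult b m := by
  rcases Base.IsPos.or_neg b i with h | h
  · exact Or.inl ⟨hi, h⟩
  · exact Or.inr ⟨neg_mem_rootsMult b m hi, h⟩

omit [Finite ι] [P.IsRootSystem] [P.IsCrystallographic] in
lemma posRootsMult_mem_closure {i : ι} (hi : i ∈ posRootsMult b m) :
    P.root i ∈ AddSubmonoid.closure (P.root '' simpleRootsMult b m) := by
  induction hN : (b.height i).toNat using Nat.strong_induction_on generalizing i with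
  | _ N ih =>
    by_cases hs : i ∈ simpleRootsMult b m
    · exact AddSubmonoid.subset_closure ⟨i, hs, rfl⟩
    · have : ∃ j ∈ posRootsMult b m, ∃ l ∈ posRootsMult b m, P.root i = P.root j + P.root l := by
        by_contra h
        exact hs ⟨hi, h⟩
      obtain ⟨j, hj, l, hl, h⟩ := this
      have hh := b.height_add h
      have h1 := hj.2
      have h2 := hl.2
      rw [Base.isPos_iff] at h1 h2
      rw [h]
      exact add_mem (ih _ (by omega) hj rfl) (ih _ (by omega) hl rfl)

-- If the pairing were positive, the difference of the two roots would be a root of R(m). Whichever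
-- of it and its negative is positive then decomposes `i` or `j`.
omit [P.IsRootSystem] in
lemma simpleRootsMult_pairingIn_nonpos {i j : ι} (hi : i ∈ simpleRootsMult b m)
    (hj : j ∈ simpleRootsMult b m) (hij : i ≠ j) : P.pairingIn ℤ i j ≤ 0 := by
  by_contra! h
  obtain ⟨l, hl⟩ := P.root_sub_root_mem_of_pairingIn_pos h hij
  have hh := b.height_sub hl
  have hlm : l ∈ rootsMult b m := by
    change (m : ℤ) ∣ _
    rw [hh]
    exact dvd_sub hi.1.1 hj.1.1
  rcases posRootsMult_or_neg b m hlm with h1 | h1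
  · exact hi.2 ⟨l, h1, j, hj.1, by rw [hl]; abel⟩
  · exact hj.2 ⟨_, h1, i, hi.1, by rw [root_neg, hl]; abel⟩

lemma isBaseOf_simpleRootsMult : IsBaseOf P (simpleRootsMult b m) (rootsMult b m) := by
  refine ⟨fun i hi => hi.1.1, ?_, fun i hi => ?_⟩
  · have : Fintype ι := Fintype.ofFinite ι
    have hB : P.RootForm.toQuadraticMap.PosDef := by
      intro x hx
      have h1 := P.rootForm_self_sum_of_squares x
      have h2 : (0 : ℝ) ≤ P.RootForm x x := h1.nonneg
      refine lt_of_le_of_ne h2 fun h3 => hx ?_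
      exact P.eq_zero_of_mem_rootSpan_of_rootForm_self_eq_zero (x := x) (by simp) h3.symm
    -- Vectors in an open half-space with pairwise non-acute angles are linearly independent; the
    -- half-space is that of positive height.
    refine LinearMap.BilinForm.linearIndependent_of_pairwise_le_zero P.RootForm hB (heightFun b)
      (fun i : simpleRootsMult b m => P.root i) (fun i => ?_) (fun i j hij => ?_)
    · rw [heightFun_root]
      exact_mod_cast i.2.1.2
    · have h1 := simpleRootsMult_pairingIn_nonpos b m i.2 j.2 (fun h => hij (Subtype.ext h))
      have h2 := P.toInvariantForm.two_mul_apply_root_root i j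
      have h3 : 0 ≤ P.RootForm (P.root j) (P.root j) :=
        (P.rootForm_self_sum_of_squares (P.root j)).nonneg
      rw [pairing_eq_pairingIn] at h2
      have h4 : ((P.pairingIn ℤ i j : ℤ) : ℝ) ≤ 0 := by exact_mod_cast h1
      have h5 : 2 * P.RootForm (P.root i) (P.root j) =
        (P.pairingIn ℤ i j : ℝ) * P.RootForm (P.root j) (P.root j) := h2
      nlinarith
  · rcases posRootsMult_or_neg b m hi with h | h
    · exact Or.inl (posRootsMult_mem_closure b m h)
    · right
      rw [← root_neg]
      exact posRootsMult_mem_closure b m h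

-- Induction on the height of `i`. If the pairing is nonpositive, the reflection does not lower the
-- height. Otherwise `l = i - j` is a root of R(m), positive because `j` is indecomposable, and the
-- induction hypothesis applies to it.
omit [P.IsRootSystem] in
lemma reflectionPerm_mem_posRootsMult [P.IsReduced] {i j : ι} (hj : j ∈ simpleRootsMult b m)
    (hi : i ∈ posRootsMult b m) (hij : i ≠ j) : P.reflectionPerm j i ∈ posRootsMult b m := by
  induction hN : (b.height i).toNat using Nat.strong_induction_on generalizing i with
  | _ N ih =>
    have hmem : P.reflectionPerm j i ∈ rootsMult b m := by
      change (m : ℤ) ∣ _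
      rw [height_reflectionPerm]
      exact dvd_sub hi.1 (Dvd.dvd.mul_left hj.1.1 _)
    have hip : 0 < b.height i := hi.2
    have hjp : 0 < b.height j := hj.1.2
    rcases le_or_gt (P.pairingIn ℤ i j) 0 with hn | hn
    · refine ⟨hmem, ?_⟩
      rw [Base.isPos_iff, height_reflectionPerm]
      nlinarith
    · obtain ⟨l, hl⟩ := P.root_sub_root_mem_of_pairingIn_pos hn hij
      have hh := b.height_sub hl
      have hlm : l ∈ rootsMult b m := by
        change (m : ℤ) ∣ _
        rw [hh]
        exact dvd_sub hi.1 hj.1.1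
      rcases posRootsMult_or_neg b m hlm with h1 | h1
      · have hlj : l ≠ j := by
          rintro rfl
          have h3 : P.root i = (2 : ℝ) • P.root l := by
            rw [two_smul]; nth_rewrite 1 [hl]; abel
          rcases IsReduced.eq_or_eq_neg (P := P) i l (by
            rw [LinearIndependent.pair_iff]
            intro h4
            have := h4 1 (-2) (by rw [h3]; module)
            simp at this) with h5 | h5
          · exact hij (P.root.injective h5)
          · have h6 := P.ne_zero l
            rw [h3] at h5
            apply h6
            have : (3 : ℝ) • P.root l = 0 := by
              have : (3 : ℝ) • P.root l = (2 : ℝ) • P.root l + P.root l := by module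
              rw [this, h5]; simp
            simpa using this
        have hlh : 0 < b.height l := h1.2
        have h2 := ih _ (by omega) h1 hlj rfl
        rcases posRootsMult_or_neg b m hmem with h3 | h3
        · exact h3
        · exfalso
          -- Since s_j(l) = s_j(i) + j, a negative s_j(i) would make j = s_j(l) + (-s_j(i))
          -- decomposable.
          refine hj.2 ⟨_, h2, _, h3, ?_⟩
          rw [root_neg, root_reflectionPerm, root_reflectionPerm, hl, map_sub]
          simp
      · exact absurd ⟨_, h1, i, hi, by rw [root_neg, hl]; abel⟩ hj.2

end SimpleRoots

/-! ### Half sums of coroots -/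

section HalfSum

variable [Fintype ι]

open Classical in
/-- If the reflection in `i ∈ Q` permutes `Q \ {i}`, then the half sum of the coroots of `Q` pairs
to `1` with the root `i`. -/
lemma toLinearMap_halfSumCoroots {Q : Set ι} {i : ι} (hi : i ∈ Q)
    (hneg : P.reflectionPerm i i ∉ Q) (h : ∀ j ∈ Q, j ≠ i → P.reflectionPerm i j ∈ Q) :
    P.toLinearMap (P.root i) (halfSumCoroots (P := P) Q) = 1 := by
  have hne : ∀ j ∈ Q, j ≠ i → P.reflectionPerm i j ≠ i := by
    rintro j hj - h1
    have h2 : j = P.reflectionPerm i i := by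
      nth_rewrite 2 [← h1]
      rw [reflectionPerm_self]
    exact hneg (h2 ▸ hj)
  set S : Finset ι := ({j | j ∈ Q} : Finset ι).erase i with hS
  -- The reflection in `i` permutes `S` and negates the pairing with `i`, so the sum is its own
  -- negative.
  have key : ∑ j ∈ S, P.pairing i j = 0 := by
    have h1 : ∑ j ∈ S, P.pairing i j = ∑ j ∈ S, -P.pairing i j := by
      refine Finset.sum_bij' (fun j _ => P.reflectionPerm i j) (fun j _ => P.reflectionPerm i j)
        ?_ ?_ ?_ ?_ ?_
      · intro j hj
        simp only [hS, Finset.mem_erase, Finset.mem_filter, Finset.mem_univ, true_and] at hj ⊢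
        exact ⟨hne j hj.2 hj.1, h j hj.2 hj.1⟩
      · intro j hj
        simp only [hS, Finset.mem_erase, Finset.mem_filter, Finset.mem_univ, true_and] at hj ⊢
        exact ⟨hne j hj.2 hj.1, h j hj.2 hj.1⟩
      · simp
      · simp
      · intro j _
        rw [pairing_reflectionPerm]; simp
    rw [Finset.sum_neg_distrib] at h1
    linarith
  have h2 : ∑ j with j ∈ Q, P.pairing i j = 2 := by
    rw [← Finset.add_sum_erase _ _ (a := i) (by simpa using hi), key]
    simp
  simp only [halfSumCoroots, map_smul, map_sum, root_coroot_eq_pairing, h2]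
  norm_num

end HalfSum

end General

end HeightSubsystem

namespace HeightSubsystem

open RootPairing

/-! ### Subsystems of Levi type -/

section Levi

variable {ι V N : Type*} [Finite ι] [AddCommGroup V] [Module ℝ V] [AddCommGroup N] [Module ℝ N]
  {P : RootPairing ι ℝ V N} [P.IsRootSystem] [P.IsCrystallographic] [P.IsReduced]

omit [Finite ι] [P.IsRootSystem] [P.IsCrystallographic] [P.IsReduced] in
lemma subset_generatedSubsystem (I : Set ι) : I ⊆ generatedSubsystem P I :=
  Set.subset_sInter fun _ hS => hS.1

omit [Finite ι] [P.IsRootSystem] [P.IsCrystallographic] [P.IsReduced] in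
lemma reflectionPerm_mem_generatedSubsystem {I : Set ι} {i j : ι}
    (hi : i ∈ generatedSubsystem P I) (hj : j ∈ generatedSubsystem P I) :
    P.reflectionPerm i j ∈ generatedSubsystem P I :=
  Set.mem_sInter.2 fun S hS => hS.2 i (Set.mem_sInter.1 hi S hS) j (Set.mem_sInter.1 hj S hS)

omit [Finite ι] [P.IsRootSystem] [P.IsCrystallographic] [P.IsReduced] in
lemma root_mem_span_of_mem_generatedSubsystem {I : Set ι} {i : ι}
    (hi : i ∈ generatedSubsystem P I) : P.root i ∈ Submodule.span ℝ (P.root '' I) := by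
  have := Set.mem_sInter.1 hi {j | P.root j ∈ Submodule.span ℝ (P.root '' I)}
    ⟨fun j hj => Submodule.subset_span ⟨j, hj, rfl⟩, fun j hj l hl => by
      simp only [Set.mem_ofPred_eq, root_reflectionPerm, reflection_apply_root] at hj hl ⊢
      exact sub_mem hl (Submodule.smul_mem _ _ hj)⟩
  exact this

/-- The expansion of the root in simple roots involves only `I` and has coefficients ≥ 0. As the
root pairs to 2 with its own coroot, some `j ∈ I` pairs positively with it. Reflecting in `j` keeps
the root positive and in the span but lowers its height, unless the root is `j` itself. -/
lemma mem_generatedSubsystem_of_isPos (b : P.Base) {I : Set ι} (hI : I ⊆ b.support) {i : ι}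
    (hp : b.IsPos i) (hi : P.root i ∈ Submodule.span ℝ (P.root '' I)) :
    i ∈ generatedSubsystem P I := by
  induction hN : (b.height i).toNat using Nat.strong_induction_on generalizing i with
  | _ n ih =>
    obtain ⟨f, hf0, hf⟩ : ∃ f : ι → ℤ, (∀ j, 0 ≤ f j) ∧ P.root i = ∑ j ∈ b.support, f j • P.root j := by
      obtain ⟨f, -, hf1, hf2⟩ := b.exists_root_eq_sum_int i
      refine ⟨f, ?_, hf2⟩
      rcases hf1 with h | h
      · exact fun j => h.le j
      · exfalso
        rw [Base.isPos_iff, Base.height_eq_sum hf2] at hp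
        exact absurd hp (not_lt.2 (Finset.sum_nonpos fun j _ => h.le j))
    have hcoord : ∀ j ∈ b.support, j ∉ I → f j = 0 := by
      intro j hj hjI
      have h1 : b.toWeightBasis.coord ⟨j, hj⟩ (P.root i) = 0 := by
        have : Submodule.span ℝ (P.root '' I) ≤ LinearMap.ker (b.toWeightBasis.coord ⟨j, hj⟩) := by
          rw [Submodule.span_le]
          rintro _ ⟨l, hl, rfl⟩
          have hlj : (⟨l, hI hl⟩ : b.support) ≠ ⟨j, hj⟩ := by
            intro h
            exact hjI (Subtype.mk.inj h ▸ hl)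
          have := b.toWeightBasis_repr_root ⟨l, hI hl⟩
          simp only [SetLike.mem_coe, LinearMap.mem_ker, Module.Basis.coord_apply] at this ⊢
          rw [this, Finsupp.single_eq_of_ne hlj.symm]
        exact this hi
      have h2 : b.toWeightBasis.coord ⟨j, hj⟩ (P.root i) = f j := by
        rw [hf, map_sum, Finset.sum_eq_single_of_mem j hj]
        · have := b.toWeightBasis_repr_root ⟨j, hj⟩
          simp only [map_zsmul, Module.Basis.coord_apply] at this ⊢
          rw [this]; simp
        · intro l hl hlj
          have := b.toWeightBasis_repr_root ⟨l, hl⟩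
          simp only [map_zsmul, Module.Basis.coord_apply] at this ⊢
          rw [this, Finsupp.single_eq_of_ne (fun h => hlj (Subtype.ext_iff.1 h).symm)]
          simp
      rw [h1] at h2
      exact_mod_cast h2.symm
    obtain ⟨j, hj, hjp⟩ : ∃ j ∈ I, 0 < P.pairingIn ℤ j i := by
      by_contra! contra
      have h2 : P.pairing i i = ∑ j ∈ b.support, f j • P.pairing j i := by
        simp only [← P.root_coroot_eq_pairing]
        nth_rewrite 1 [hf]
        simp
      have h3 : ∑ j ∈ b.support, f j • P.pairing j i ≤ 0 := by
        refine Finset.sum_nonpos fun j hj => ?_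
        by_cases hjI : j ∈ I
        · rw [pairing_eq_pairingIn, zsmul_eq_mul]
          have := contra j hjI
          have h4 := hf0 j
          exact_mod_cast mul_nonpos_of_nonneg_of_nonpos h4 this
        · simp [hcoord j hj hjI]
      rw [← h2, pairing_same] at h3
      linarith
    by_cases hij : i = j
    · subst hij
      exact subset_generatedSubsystem I hj
    · have hpos := hp.reflectionPerm (hI hj) hij
      have hh := height_reflectionPerm b i j
      rw [P.zero_lt_pairingIn_iff'] at hjp
      rw [Base.height_one_of_mem_support (hI hj)] at hh
      have h0 : 0 < b.height i := hp
      have h1 := ih _ (by omega) hpos (by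
        rw [root_reflectionPerm, reflection_apply_root]
        exact sub_mem hi (Submodule.smul_mem _ _ (Submodule.subset_span ⟨j, hj, rfl⟩))) rfl
      have h2 := reflectionPerm_mem_generatedSubsystem (subset_generatedSubsystem (P := P) I hj) h1
      rwa [reflectionPerm_self] at h2

lemma mem_generatedSubsystem_iff (b : P.Base) {I : Set ι} (hI : I ⊆ b.support) {i : ι} :
    i ∈ generatedSubsystem P I ↔ P.root i ∈ Submodule.span ℝ (P.root '' I) := by
  refine ⟨root_mem_span_of_mem_generatedSubsystem, fun hi => ?_⟩
  rcases Base.IsPos.or_neg b i with h | h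
  · exact mem_generatedSubsystem_of_isPos b hI h hi
  · have h1 := mem_generatedSubsystem_of_isPos b hI h
      (by change P.root (P.reflectionPerm i i) ∈ _; rw [root_neg]; exact neg_mem hi)
    have h2 := reflectionPerm_mem_generatedSubsystem h1 h1
    have h3 : P.reflectionPerm (P.reflectionPerm i i) (P.reflectionPerm i i) = i := by
      apply P.root.injective
      rw [root_neg, root_neg, neg_neg]
    exact h3 ▸ h2

/-- A subsystem of Levi type contains all roots in its span. -/
lemma IsLeviType.mem_of_mem_span {b : P.Base} {Q : Set ι} (hQ : IsLeviType b Q) {i : ι}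
    (hi : P.root i ∈ Submodule.span ℝ (P.root '' Q)) : i ∈ Q := by
  obtain ⟨w, I, hI, rfl⟩ := hQ
  refine ⟨P.weylGroupToPerm w⁻¹ i, ?_, by simp⟩
  rw [mem_generatedSubsystem_iff b hI, ← weylGroup_apply_root]
  let φ : V →ₗ[ℝ] V := DistribSMul.toLinearMap ℝ V w⁻¹
  have h1 : φ (P.root i) ∈ (Submodule.span ℝ
      (P.root '' (P.weylGroupToPerm w '' generatedSubsystem P I))).map φ :=
    Submodule.mem_map_of_mem hi
  rw [Submodule.map_span] at h1
  refine Submodule.span_le.2 ?_ h1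
  rintro _ ⟨_, ⟨_, ⟨j, hj, rfl⟩, rfl⟩, rfl⟩
  have : φ (P.root (P.weylGroupToPerm w j)) = P.root j := by
    change w⁻¹ • P.root (P.weylGroupToPerm w j) = _
    rw [← weylGroup_apply_root, inv_smul_smul]
  rw [this]
  exact root_mem_span_of_mem_generatedSubsystem hj

omit [P.IsRootSystem] in
/-- Every element of `N` is conjugate to a dominant one. -/
lemma exists_dominant (b : P.Base) (φ : N) :
    ∃ w : P.weylGroup, ∀ i ∈ b.support, 0 ≤ P.root' (P.weylGroupToPerm w i) φ := by
  classical
  have : Fintype ι := Fintype.ofFinite ι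
  let F : Equiv.Perm ι → ℝ := fun g => ∑ i with b.IsPos i, P.root' (g i) φ
  -- Maximise over the Weyl group the sum of the values of φ on the images of the positive roots.
  -- Passing from `w` to `w * s_i` permutes all terms but that of `i`, which changes sign; by
  -- maximality this term is nonnegative.
  obtain ⟨_, ⟨w, rfl⟩, hw⟩ := Set.exists_max_image (Set.range P.weylGroupToPerm) F
    (Set.toFinite _) ⟨_, ⟨1, rfl⟩⟩
  refine ⟨w, fun i hi => ?_⟩
  have h1 := hw _ ⟨w * weylGroup.ofIdx P i, rfl⟩
  have hrefl : P.weylGroupToPerm (weylGroup.ofIdx P i) = P.reflectionPerm i := by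
    simp [weylGroup.ofIdx]
  have hip : b.IsPos i := Base.isPos_of_mem_support hi
  have hmem : i ∈ ({j | b.IsPos j} : Finset ι) := by simpa using hip
  simp only [F, map_mul, hrefl, Equiv.Perm.mul_apply] at h1
  rw [← Finset.add_sum_erase _ _ hmem, ← Finset.add_sum_erase _ _ hmem] at h1
  have h2 : ∑ x ∈ ({j | b.IsPos j} : Finset ι).erase i,
      P.root' (P.weylGroupToPerm w (P.reflectionPerm i x)) φ =
      ∑ x ∈ ({j | b.IsPos j} : Finset ι).erase i, P.root' (P.weylGroupToPerm w x) φ := by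
    have aux : ∀ x ∈ ({j | b.IsPos j} : Finset ι).erase i,
        P.reflectionPerm i x ∈ ({j | b.IsPos j} : Finset ι).erase i := by
      intro x hx
      simp only [Finset.mem_erase, Finset.mem_filter, Finset.mem_univ, true_and] at hx ⊢
      refine ⟨fun h => ?_, hx.2.reflectionPerm hi hx.1⟩
      have h3 : x = P.reflectionPerm i i := by
        nth_rewrite 2 [← h]
        rw [reflectionPerm_self]
      have h4 := hx.2
      rw [h3, Base.isPos_iff, height_neg] at h4
      rw [Base.isPos_iff] at hip
      omega
    exact Finset.sum_bij' (fun x _ => P.reflectionPerm i x) (fun x _ => P.reflectionPerm i x)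
      aux aux (by simp) (by simp) (by simp)
  rw [h2] at h1
  have h3 : P.root' (P.weylGroupToPerm w (P.reflectionPerm i i)) φ =
      -P.root' (P.weylGroupToPerm w i) φ := by
    change P.toLinearMap (P.root _) φ = -P.toLinearMap (P.root _) φ
    rw [← weylGroup_apply_root, ← weylGroup_apply_root, root_neg, smul_neg, map_neg]
    rfl
  rw [h3] at h1
  linarith

/-- The roots orthogonal to an element of `N` form a subsystem of Levi type. -/
lemma isLeviType_orthogonal (b : P.Base) (φ : N) : IsLeviType b {i | P.root' i φ = 0} := by
  obtain ⟨w, hw⟩ := exists_dominant b φ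
  let I : Set ι := {i | i ∈ b.support ∧ P.root' (P.weylGroupToPerm w i) φ = 0}
  have hI : I ⊆ b.support := fun i hi => hi.1
  let ψ : V →ₗ[ℝ] ℝ := (P.toLinearMap.flip φ) ∘ₗ DistribSMul.toLinearMap ℝ V w
  have hψ : ∀ i, ψ (P.root i) = P.root' (P.weylGroupToPerm w i) φ := by
    intro i
    change P.toLinearMap (w • P.root i) φ = _
    rw [weylGroup_apply_root]
  have hmain : ∀ i, P.root' (P.weylGroupToPerm w i) φ = 0 ↔ i ∈ generatedSubsystem P I := by
    intro i
    rw [mem_generatedSubsystem_iff b hI, ← hψ]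
    constructor
    · intro h
      obtain ⟨f, -, hf⟩ := b.exists_root_eq_sum_nat_or_neg i
      have h1 : ∑ j ∈ b.support, f j • ψ (P.root j) = 0 := by
        rcases hf with hf | hf <;> rw [hf] at h <;> simpa using h
      -- By dominance all terms are nonnegative, so a vanishing sum leaves only simple roots in `I`
      -- with nonzero coefficient.
      have h2 : ∀ j ∈ b.support, f j • ψ (P.root j) = 0 := by
        refine (Finset.sum_eq_zero_iff_of_nonneg fun j hj => ?_).1 h1
        rw [hψ]
        exact nsmul_nonneg (hw j hj) _
      have h3 : ∑ j ∈ b.support, f j • P.root j ∈ Submodule.span ℝ (P.root '' I) := by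
        refine Submodule.sum_mem _ fun j hj => ?_
        have h4 := h2 j hj
        rw [nsmul_eq_mul, mul_eq_zero] at h4
        rcases h4 with h4 | h4
        · rw [Nat.cast_eq_zero] at h4
          rw [h4, zero_smul]
          exact zero_mem _
        · exact Submodule.smul_of_tower_mem _ _
            (Submodule.subset_span ⟨j, ⟨hj, by rw [← hψ, h4]⟩, rfl⟩)
      rcases hf with hf | hf <;> rw [hf]
      · exact h3
      · exact neg_mem h3
    · intro h
      have : Submodule.span ℝ (P.root '' I) ≤ LinearMap.ker ψ := by
        rw [Submodule.span_le]
        rintro _ ⟨j, hj, rfl⟩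
        change ψ _ = 0
        rw [hψ]
        exact hj.2
      exact this h
  refine ⟨w, I, hI, ?_⟩
  ext i
  constructor
  · intro hi
    refine ⟨P.weylGroupToPerm w⁻¹ i, ?_, by simp⟩
    rw [← hmain]
    simpa using hi
  · rintro ⟨j, hj, rfl⟩
    exact (hmain j).2 hj

end Levi

end HeightSubsystem

set_option linter.unusedSimpArgs false

namespace HeightSubsystem

open RootPairing

/-! ### Families of vectors with a given diagram -/

section Chains

variable {E : Type*} [AddCommGroup E] [Module ℝ E]

/-- The squared length of `ε_0`, which is `0` in type `B_n`. -/
def Family.sq : Family → ℝ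
  | .B => 0
  | .D => 1

/-- The vectors `v` have the Cartan matrix `A` with respect to the form `g`. -/
def Represents (g : E →ₗ[ℝ] E →ₗ[ℝ] ℝ) {κ : Type} (v : κ → E) (A : Matrix κ κ ℤ) : Prop :=
  ∀ x y, 2 * g (v x) (v y) = A x y * g (v y) (v y)

/-- The simple roots of a diagram `B_q` or `D_{q+1}`, for `u` the unit vectors. -/
def chainVec (X : Family) (u : ℕ → E) (q : ℕ) (x : Fin (X.rank q)) : E :=
  if (x : ℕ) = q then u 1 + u 0 else u (q - x) - u (q - x - 1)

/-- The simple roots of a diagram `A_l`, for `u` the unit vectors. -/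
def stepVec (u : ℕ → E) (l : ℕ) (x : Fin l) : E := u (x + 1) - u x

lemma form_sub_sub (g : E →ₗ[ℝ] E →ₗ[ℝ] ℝ) (u : ℕ → E) (q : ℕ) (w : ℕ → ℝ)
    (hu : ∀ a b, a ≤ q → b ≤ q → g (u a) (u b) = if a = b then w a else 0) {i j : ℕ}
    (hi : i < q) (hj : j < q) :
    g (u (i + 1) - u i) (u (j + 1) - u j) =
      if i = j then w (i + 1) + w i else if i = j + 1 then -w i
        else if j = i + 1 then -w j else 0 := by
  simp only [map_sub, LinearMap.sub_apply]
  rw [hu _ _ (by omega) (by omega), hu _ _ (by omega) (by omega), hu _ _ (by omega) (by omega),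
    hu _ _ (by omega) (by omega)]
  obtain rfl | rfl | rfl | ⟨h1, h2, h3⟩ :
      i = j ∨ i = j + 1 ∨ j = i + 1 ∨ (i ≠ j ∧ i ≠ j + 1 ∧ j ≠ i + 1) := by omega
  all_goals
    simp (disch := omega) only [true_or, or_true, true_and, if_true, if_false, if_pos, if_neg]
    ring

lemma BD_B_apply (q : ℕ) (x y : Fin q) : Family.B.BD q x y =
    if (x : ℕ) = y then 2 else if (x : ℕ) + 1 = y then if (y : ℕ) = q - 1 then -2 else -1
      else if (y : ℕ) + 1 = x then -1 else 0 := by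
  simp [Family.BD, CartanMatrix.B, Fin.ext_iff]

lemma BD_D_apply (q : ℕ) (x y : Fin (q + 1)) : Family.D.BD q x y =
    if (x : ℕ) = y then 2
    else if q ≤ 1 then 0
    else if (x : ℕ) + 1 = y ∧ (y : ℕ) + 1 < q then -1
    else if (y : ℕ) + 1 = x ∧ (x : ℕ) + 1 < q then -1
    else if (x : ℕ) + 2 = q ∧ ((y : ℕ) + 1 = q ∨ (y : ℕ) = q) then -1
    else if (y : ℕ) + 2 = q ∧ ((x : ℕ) + 1 = q ∨ (x : ℕ) = q) then -1
    else 0 := by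
  simp only [Family.BD, CartanMatrix.D, Fin.ext_iff, Matrix.of_apply]
  have hx := x.2
  have hy := y.2
  split_ifs <;> first | rfl | omega

/-- The squared length of `u 0` unites the two families: the value 0 makes `u 1 - u 0` the short
root of B_q, the value 1 gives the fork `u 1 ± u 0` of D_{q+1}. Only the Gram matrix enters, and q =
1 covers B_1 = A_1 and D_2 = 2A_1. -/
lemma represents_chainVec (X : Family) (g : E →ₗ[ℝ] E →ₗ[ℝ] ℝ) (u : ℕ → E) (q : ℕ) (hq : 1 ≤ q)
    (hu : ∀ a b, a ≤ q → b ≤ q → g (u a) (u b) = if a = b then (if a = 0 then X.sq else 1) else 0) :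
    Represents g (chainVec X u q) (X.BD q) := by
  have hd : ∀ x y : ℕ, x < q → y < q →
      g (u (q - x) - u (q - x - 1)) (u (q - y) - u (q - y - 1)) =
        if x = y then (if x + 1 = q then 1 + X.sq else 2)
          else if x + 1 = y ∨ y + 1 = x then -1 else 0 := by
    intro x y hx hy
    have h := form_sub_sub g u q _ hu (show q - x - 1 < q by omega) (show q - y - 1 < q by omega)
    rw [show q - x - 1 + 1 = q - x by omega, show q - y - 1 + 1 = q - y by omega] at h
    rw [h]
    obtain rfl | rfl | rfl | ⟨h1, h2, h3⟩ :
      x = y ∨ x + 1 = y ∨ y + 1 = x ∨ (x ≠ y ∧ x + 1 ≠ y ∧ y + 1 ≠ x) := by omega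
    · by_cases hx1 : x + 1 = q
      · simp (disch := omega) only [true_or, or_true, true_and, if_true, if_false, if_pos, if_neg]
      · simp (disch := omega) only [true_or, or_true, true_and, if_true, if_false, if_pos, if_neg]
        norm_num
    all_goals simp (disch := omega) only [true_or, or_true, true_and, if_true, if_false, if_pos, if_neg]
  intro x y
  have hx := x.2
  have hy := y.2
  cases X
  · simp only [Family.rank] at hx hy
    have hxq : (x : ℕ) ≠ q := by omega
    have hyq : (y : ℕ) ≠ q := by omega
    simp only [chainVec, hxq, hyq, if_false]
    rw [hd _ _ hx hy, hd _ _ hy hy, BD_B_apply q x y, if_pos rfl]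
    simp only [Family.sq]
    generalize (x : ℕ) = i at *
    generalize (y : ℕ) = j at *
    obtain rfl | rfl | rfl | ⟨h1, h2, h3⟩ :
      i = j ∨ i + 1 = j ∨ j + 1 = i ∨ (i ≠ j ∧ i + 1 ≠ j ∧ j + 1 ≠ i) := by omega
    · simp
    · by_cases hx1 : i + 1 + 1 = q
      all_goals
        simp (disch := omega) only [true_or, or_true, true_and, if_true, if_false, if_pos, if_neg]
        norm_num
    all_goals
      simp (disch := omega) only [true_or, or_true, true_and, if_true, if_false, if_pos, if_neg]
      norm_num
  · simp only [Family.rank] at hx hy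
    simp only [Family.sq, ite_self] at hu
    simp only [Family.sq, show (1 : ℝ) + 1 = 2 by norm_num, ite_self] at hd
    rw [BD_D_apply q x y]
    have hs : g (u 1 + u 0) (u 1 + u 0) = 2 := by
      simp only [map_add, LinearMap.add_apply]
      rw [hu _ _ (by omega) (by omega), hu _ _ (by omega) (by omega), hu _ _ (by omega) (by omega),
        hu _ _ (by omega) (by omega)]
      norm_num
    simp only [chainVec]
    generalize (x : ℕ) = i at *
    generalize (y : ℕ) = j at *
    have hq' : j + 1 = q ∨ j + 2 = q ∨ j + 2 < q ∨ j = q := by omega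
    have hq'' : i + 1 = q ∨ i + 2 = q ∨ i + 2 < q ∨ i = q := by omega
    by_cases hxq : i = q <;> by_cases hyq : j = q
    · subst hxq hyq
      simp only [if_true, hs]
      norm_num
    · rw [if_pos hxq, if_neg hyq, hd _ _ (by omega) (by omega), if_pos rfl]
      simp only [map_add, LinearMap.add_apply, map_sub]
      rw [hu _ _ (by omega) (by omega), hu _ _ (by omega) (by omega), hu _ _ (by omega) (by omega),
        hu _ _ (by omega) (by omega)]
      rcases Nat.lt_or_ge 1 q with hq1 | hq1 <;> obtain h | h | h | h := hq'
      all_goals first | omega | skip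
      all_goals
        simp (disch := omega) only [true_or, or_true, true_and, if_true, if_false, if_pos, if_neg]
        norm_num
    · rw [if_pos hyq, if_neg hxq, hs]
      simp only [map_add, LinearMap.sub_apply, map_sub]
      rw [hu _ _ (by omega) (by omega), hu _ _ (by omega) (by omega), hu _ _ (by omega) (by omega),
        hu _ _ (by omega) (by omega)]
      rcases Nat.lt_or_ge 1 q with hq1 | hq1 <;> obtain h | h | h | h := hq''
      all_goals first | omega | skip
      all_goals
        simp (disch := omega) only [true_or, or_true, true_and, if_true, if_false, if_pos, if_neg]
        norm_num
    · rw [if_neg hyq, if_neg hxq, hd _ _ (by omega) (by omega), hd _ _ (by omega) (by omega),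
        if_pos rfl]
      obtain rfl | rfl | rfl | ⟨h1, h2, h3⟩ :
        i = j ∨ i + 1 = j ∨ j + 1 = i ∨ (i ≠ j ∧ i + 1 ≠ j ∧ j + 1 ≠ i) := by omega
      · simp
      · by_cases hx1 : i + 1 + 1 = q
        all_goals
          simp (disch := omega) only [true_or, or_true, true_and, if_true, if_false, if_pos, if_neg]
          norm_num
          try omega
      · by_cases hx1 : j + 1 + 1 = q
        all_goals
          simp (disch := omega) only [true_or, or_true, true_and, if_true, if_false, if_pos, if_neg]
          norm_num
          try omega
      · by_cases hq1 : q ≤ 1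
        all_goals
          simp (disch := omega) only [true_or, or_true, true_and, if_true, if_false, if_pos, if_neg]
          norm_num

lemma represents_stepVec (g : E →ₗ[ℝ] E →ₗ[ℝ] ℝ) (u : ℕ → E) (l : ℕ)
    (hu : ∀ a b, a ≤ l → b ≤ l → g (u a) (u b) = if a = b then 1 else 0) :
    Represents g (stepVec u l) (typeA l) := by
  intro x y
  simp only [stepVec]
  rw [form_sub_sub g u l _ hu x.2 y.2, form_sub_sub g u l _ hu y.2 y.2]
  simp only [CartanMatrix.A, Matrix.of_apply, Fin.ext_iff]
  split_ifs <;> first | omega | norm_num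

lemma Represents.sum {g : E →ₗ[ℝ] E →ₗ[ℝ] ℝ} {κ κ' : Type} {v : κ → E} {w : κ' → E}
    {A : Matrix κ κ ℤ} {B : Matrix κ' κ' ℤ} (hv : Represents g v A) (hw : Represents g w B)
    (h : ∀ x y, g (v x) (w y) = 0) (h' : ∀ x y, g (w y) (v x) = 0) :
    Represents g (Sum.elim v w) (A ⊕ᴅ B) := by
  rintro (x | x) (y | y)
  · simpa [diagramSum] using hv x y
  · simp [diagramSum, h]
  · simp [diagramSum, h']
  · simpa [diagramSum] using hw x y

lemma represents_copies {g : E →ₗ[ℝ] E →ₗ[ℝ] ℝ} {κ : Type} {c : ℕ} {v : Fin c → κ → E}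
    {A : Matrix κ κ ℤ} (hv : ∀ s, Represents g (v s) A)
    (h : ∀ s s' x y, s ≠ s' → g (v s x) (v s' y) = 0) :
    Represents g (fun z : κ × Fin c => v z.2 z.1) (copies c A) := by
  rintro ⟨x, s⟩ ⟨y, s'⟩
  by_cases hs : s = s'
  · subst hs
    simpa [copies, Matrix.blockDiagonal_apply] using hv s x y
  · simp [copies, Matrix.blockDiagonal_apply, hs, h s s' x y hs]

/-- The off-diagonal entries of `A` are nonpositive. -/
def OffDiagNonpos {κ : Type} (A : Matrix κ κ ℤ) : Prop := ∀ x y, x ≠ y → A x y ≤ 0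

lemma OffDiagNonpos.sum {κ κ' : Type} {A : Matrix κ κ ℤ} {B : Matrix κ' κ' ℤ}
    (hA : OffDiagNonpos A) (hB : OffDiagNonpos B) : OffDiagNonpos (A ⊕ᴅ B) := by
  rintro (x | x) (y | y) h
  · simpa [diagramSum] using hA x y fun h' => h (congrArg _ h')
  · simp [diagramSum]
  · simp [diagramSum]
  · simpa [diagramSum] using hB x y fun h' => h (congrArg _ h')

lemma OffDiagNonpos.copies {κ : Type} {A : Matrix κ κ ℤ} (hA : OffDiagNonpos A) (c : ℕ) :
    OffDiagNonpos (copies c A) := by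
  rintro ⟨x, s⟩ ⟨y, s'⟩ h
  by_cases hs : s = s'
  · subst hs
    simpa [HeightSubsystem.copies, Matrix.blockDiagonal_apply] using
      hA x y fun h' => h (by rw [h'])
  · simp [HeightSubsystem.copies, Matrix.blockDiagonal_apply, hs]

lemma offDiagNonpos_A (l : ℕ) : OffDiagNonpos (typeA l) :=
  fun x y => CartanMatrix.A_apply_le_zero_of_ne l x y

lemma offDiagNonpos_BD (X : Family) (q : ℕ) : OffDiagNonpos (X.BD q) := by
  cases X
  · exact fun x y => CartanMatrix.B_off_diag_nonpos q x y
  · exact fun x y => CartanMatrix.D_off_diag_nonpos (q + 1) x y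

end Chains

end HeightSubsystem

set_option linter.unusedSimpArgs false

namespace HeightSubsystem

open RootPairing

/-! ### The standard realization -/

section Realization

lemma Family.sq_mul_self (X : Family) : X.sq * X.sq = X.sq := by cases X <;> simp [Family.sq]

variable {ι V N : Type*} [AddCommGroup V] [Module ℝ V] [AddCommGroup N] [Module ℝ N]
  {P : RootPairing ι ℝ V N} {b : P.Base}

/-- The vectors `ε_0, …, ε_n` realize the root system with base `b` in the standard way. -/
structure Realization [P.IsRootSystem] (X : Family) (n : ℕ) (e : Fin (X.rank n) ≃ b.support)
    (ε : ℕ → V) (g : V →ₗ[ℝ] V →ₗ[ℝ] ℝ) : Prop where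
  form_eps : ∀ a c, a ≤ n → c ≤ n →
    g (ε a) (ε c) = if a = c then (if a = 0 then X.sq else 1) else 0
  form_symm : ∀ v w, g v w = g w v
  pairing_mul : ∀ i j, P.pairing i j * g (P.root j) (P.root j) = 2 * g (P.root i) (P.root j)
  height_eps : ∀ a ≤ n, heightFun b (ε a) = a
  eps_zero : X.sq = 0 → ε 0 = 0
  simple_succ : ∀ j, 1 ≤ j → j ≤ n → simpleRoot X n e j = ε j - ε (j - 1)
  simple_zero : X.sq = 1 → simpleRoot X n e 0 = ε 1 + ε 0
  exists_sub : ∀ a c, a < c → c ≤ n → ∃ i, P.root i = ε c - ε a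
  exists_add : ∀ a c, a < c → c ≤ n → ∃ i, P.root i = ε c + ε a
  pos_cases : ∀ i, b.IsPos i →
    ∃ a c, a < c ∧ c ≤ n ∧ (P.root i = ε c - ε a ∨ P.root i = ε c + ε a)

/-- The dot product of the first `n + 1` coordinates. -/
noncomputable def dotForm (n : ℕ) : (ℕ → ℝ) →ₗ[ℝ] (ℕ → ℝ) →ₗ[ℝ] ℝ :=
  LinearMap.mk₂ ℝ (fun v w => ∑ c ∈ Finset.range (n + 1), v c * w c)
    (fun v w x => by simp [add_mul, Finset.sum_add_distrib])
    (fun r v w => by simp [Finset.mul_sum, mul_assoc])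
    (fun v w x => by simp [mul_add, Finset.sum_add_distrib])
    (fun r v w => by simp [Finset.mul_sum, mul_left_comm])

/-- The coordinate vector of `ε_a`. -/
noncomputable def unitVec (X : Family) (a : ℕ) : ℕ → ℝ :=
  if a = 0 then X.sq • Pi.single 0 1 else Pi.single a 1

lemma dotForm_unitVec (X : Family) (n a c : ℕ) (ha : a ≤ n) (hc : c ≤ n) :
    dotForm n (unitVec X a) (unitVec X c) = if a = c then (if a = 0 then X.sq else 1) else 0 := by
  have h1 : ∀ a c : ℕ, a ≤ n → ∑ k ∈ Finset.range (n + 1), (Pi.single a (1 : ℝ) : ℕ → ℝ) k *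
      (Pi.single c (1 : ℝ) : ℕ → ℝ) k = if a = c then 1 else 0 := by
    intro a c ha
    rw [Finset.sum_eq_single_of_mem a (by simp; omega)]
    · simp [Pi.single_apply]
    · intro k _ hk
      simp [Pi.single_apply, hk]
  have h2 : ∀ a c : ℕ, a ≤ n →
      dotForm n (Pi.single a (1 : ℝ)) (Pi.single c (1 : ℝ)) = if a = c then 1 else 0 := h1
  unfold unitVec
  by_cases ha0 : a = 0 <;> by_cases hc0 : c = 0
  · subst ha0 hc0
    simp only [if_true, map_smul, LinearMap.smul_apply, smul_eq_mul, h2 0 0 ha, mul_one,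
      X.sq_mul_self]
  · subst ha0
    rw [if_pos rfl, if_neg hc0, map_smul, LinearMap.smul_apply, h2 0 c ha, if_neg (Ne.symm hc0),
      if_neg (Ne.symm hc0), smul_zero]
  · subst hc0
    rw [if_pos rfl, if_neg ha0, map_smul, h2 a 0 ha, if_neg ha0, if_neg ha0, smul_zero]
  · rw [if_neg ha0, if_neg ha0, if_neg hc0, h2 a c ha]

variable [P.IsRootSystem] (X : Family) (n : ℕ) (e : Fin (X.rank n) ≃ b.support)

/-- The coordinates with respect to `ε_0, …, ε_n`. -/
noncomputable def coordMap : V →ₗ[ℝ] (ℕ → ℝ) :=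
  b.toWeightBasis.constr ℝ fun s => chainVec X (unitVec X) n (e.symm s)

/-- The standard scalar product. -/
noncomputable def stdForm : V →ₗ[ℝ] V →ₗ[ℝ] ℝ :=
  (dotForm n).compl₁₂ (coordMap X n e) (coordMap X n e)

omit [P.IsRootSystem] in
/-- The unit vector `ε_a`. -/
noncomputable def eps (a : ℕ) : V :=
  -- In type D, α_0 - α_1 = 2ε_0; in type B this term vanishes. Adding α_1, …, α_a then moves from
  -- ε_0 to ε_a.
  (X.sq / 2) • (simpleRoot X n e 0 - simpleRoot X n e 1) +
    ∑ j ∈ Finset.Icc 1 a, simpleRoot X n e j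

omit [P.IsRootSystem] in
lemma eps_succ (a : ℕ) : eps X n e (a + 1) = eps X n e a + simpleRoot X n e (a + 1) := by
  rw [eps, eps, Finset.sum_Icc_succ_top (by omega), add_assoc]

omit [P.IsRootSystem] in
lemma simpleRoot_succ (j : ℕ) (hj : 1 ≤ j) :
    simpleRoot X n e j = eps X n e j - eps X n e (j - 1) := by
  obtain ⟨a, rfl⟩ : ∃ a, j = a + 1 := ⟨j - 1, by omega⟩
  rw [eps_succ, Nat.add_sub_cancel]
  abel

omit [P.IsRootSystem] in
lemma simpleRoot_zero (hX : X.sq = 1) : simpleRoot X n e 0 = eps X n e 1 + eps X n e 0 := by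
  rw [eps, eps, hX]
  simp
  module

omit [P.IsRootSystem] in
lemma eps_zero_of_sq (hX : X.sq = 0) : eps X n e 0 = 0 := by simp [eps, hX]

lemma coordMap_root (x : Fin (X.rank n)) :
    coordMap X n e (P.root (e x)) = chainVec X (unitVec X) n x := by
  have h := b.toWeightBasis.constr_basis ℝ (fun s => chainVec X (unitVec X) n (e.symm s)) (e x)
  simpa [coordMap] using h

omit [P.IsRootSystem] in
lemma rank_le : n ≤ X.rank n ∧ X.rank n ≤ n + 1 := by cases X <;> simp [Family.rank]

omit [P.IsRootSystem] in
lemma simpleRoot_eq (x : Fin (X.rank n)) (hx : (x : ℕ) ≤ n) :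
    simpleRoot X n e (n - x) = P.root (e x) := by
  have h : n - (n - (x : ℕ)) = x := by omega
  have hx2 := x.2
  rw [simpleRoot, dif_pos ⟨by omega, by omega⟩]
  congr 3
  exact Fin.ext h

lemma coordMap_simpleRoot_succ (j : ℕ) (hj : 1 ≤ j) (hjn : j ≤ n) :
    coordMap X n e (simpleRoot X n e j) = unitVec X j - unitVec X (j - 1) := by
  have hr := rank_le X n
  have h := simpleRoot_eq X n e ⟨n - j, by omega⟩ (by simp)
  simp only [show n - (n - j) = j by omega] at h
  rw [h, coordMap_root, chainVec, if_neg (by simp only; omega)]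
  simp only [show n - (n - j) = j by omega]

lemma coordMap_eps (hn : 1 ≤ n) (a : ℕ) (ha : a ≤ n) :
    coordMap X n e (eps X n e a) = unitVec X a := by
  induction a with
  | zero =>
    cases X with
    | B => simp [eps, Family.sq, unitVec]
    | D =>
      have h0 : coordMap .D n e (simpleRoot .D n e 0) = unitVec .D 1 + unitVec .D 0 := by
        have h := simpleRoot_eq .D n e ⟨n, by simp [Family.rank]⟩ le_rfl
        simp only [Nat.sub_self] at h
        rw [h, coordMap_root, chainVec, if_pos rfl]
      have h1 := coordMap_simpleRoot_succ .D n e 1 le_rfl hn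
      simp only [eps, map_add, map_smul, map_sub, h0, h1, Family.sq]
      simp
      module
  | succ a ih =>
    rw [eps_succ, map_add, ih (by omega), coordMap_simpleRoot_succ X n e _ (by omega) ha,
      Nat.add_sub_cancel]
    abel

lemma stdForm_eps (hn : 1 ≤ n) (a c : ℕ) (ha : a ≤ n) (hc : c ≤ n) :
    stdForm X n e (eps X n e a) (eps X n e c) =
      if a = c then (if a = 0 then X.sq else 1) else 0 := by
  rw [stdForm, LinearMap.compl₁₂_apply, coordMap_eps X n e hn a ha, coordMap_eps X n e hn c hc,
    dotForm_unitVec X n a c ha hc]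

lemma stdForm_symm (v w : V) : stdForm X n e v w = stdForm X n e w v := by
  simp only [stdForm, LinearMap.compl₁₂_apply, dotForm, LinearMap.mk₂_apply, mul_comm]

omit [P.IsRootSystem] in
/-- The simple roots in terms of the `ε_a`. -/
lemma simple_cases {s : ι} (hs : s ∈ b.support) :
    (∃ j, 1 ≤ j ∧ j ≤ n ∧ P.root s = eps X n e j - eps X n e (j - 1)) ∨
      (X.sq = 1 ∧ P.root s = eps X n e 1 + eps X n e 0) := by
  obtain ⟨x, hx⟩ := e.surjective ⟨s, hs⟩
  have hr := rank_le X n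
  have hx2 := x.2
  have h := simpleRoot_eq X n e x (by omega)
  rw [hx] at h
  simp only at h
  by_cases hxn : (x : ℕ) = n
  · right
    have hX : X.sq = 1 := by
      cases X
      · simp [Family.rank] at hx2; omega
      · rfl
    rw [← h, hxn, Nat.sub_self]
    exact ⟨hX, simpleRoot_zero X n e hX⟩
  · left
    exact ⟨n - x, by omega, by omega, by rw [← h, simpleRoot_succ X n e _ (by omega)]⟩

/-- Both sides are linear in `v`, so it suffices to take `v` simple, where the claim compares the
Cartan matrix given by `he` with the Gram matrix of `chainVec`. Invariance of the form under simple
reflections follows. -/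
lemma stdForm_coroot_simple [P.IsCrystallographic]
    (hn : 1 ≤ n) (he : ∀ x y, b.cartanMatrix (e x) (e y) = X.BD n x y) {s : ι}
    (hs : s ∈ b.support) (v : V) :
    P.coroot' s v * stdForm X n e (P.root s) (P.root s) = 2 * stdForm X n e v (P.root s) := by
  obtain ⟨x, hx⟩ := e.surjective ⟨s, hs⟩
  have hrep := represents_chainVec X (dotForm n) (unitVec X) n hn (dotForm_unitVec X n)
  suffices h : (stdForm X n e (P.root s) (P.root s)) • P.coroot' s =
      (2 : ℝ) • (stdForm X n e).flip (P.root s) by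
    have := LinearMap.congr_fun h v
    simp only [LinearMap.smul_apply, smul_eq_mul, LinearMap.flip_apply] at this ⊢
    linarith
  refine b.toWeightBasis.ext fun t => ?_
  obtain ⟨y, rfl⟩ := e.surjective t
  have hse : s = e x := by rw [hx]
  subst hse
  rw [Base.toWeightBasis_apply]
  have h1 := hrep y x
  rw [← coordMap_root X n e, ← coordMap_root X n e] at h1
  have h2 : P.pairing (e y) (e x) = (X.BD n y x : ℝ) := by
    rw [← he, Base.cartanMatrix, Base.cartanMatrixIn_def, pairing_eq_pairingIn]
  simp only [LinearMap.smul_apply, smul_eq_mul, LinearMap.flip_apply, root_coroot'_eq_pairing,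
    root_coroot_eq_pairing]
  rw [h2]
  simp only [stdForm, LinearMap.compl₁₂_apply]
  linarith

lemma stdForm_reflection [P.IsCrystallographic]
    (hn : 1 ≤ n) (he : ∀ x y, b.cartanMatrix (e x) (e y) = X.BD n x y) {s : ι}
    (hs : s ∈ b.support) (v w : V) :
    stdForm X n e (P.reflection s v) (P.reflection s w) = stdForm X n e v w := by
  have h1 := stdForm_coroot_simple X n e hn he hs v
  have h2 := stdForm_coroot_simple X n e hn he hs w
  rw [stdForm_symm X n e w] at h2
  simp only [reflection_apply, map_sub, map_smul, LinearMap.sub_apply, LinearMap.smul_apply,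
    smul_eq_mul]
  linear_combination (P.coroot' s w / 2) * h1 + (P.coroot' s v / 2) * h2

/-- Every root is reached from simple ones by negation and simple reflections; the latter preserve
the form, so the identity for simple roots carries over. -/
lemma stdForm_coroot [Finite ι] [P.IsCrystallographic] [P.IsReduced]
    (hn : 1 ≤ n) (he : ∀ x y, b.cartanMatrix (e x) (e y) = X.BD n x y) (i : ι) (v : V) :
    P.coroot' i v * stdForm X n e (P.root i) (P.root i) = 2 * stdForm X n e v (P.root i) := by
  revert v
  refine Base.induction_reflect (b := b) i (p := fun i => ∀ v,
    P.coroot' i v * stdForm X n e (P.root i) (P.root i) = 2 * stdForm X n e v (P.root i)) ?_ ?_ ?_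
  · intro i h v
    have h1 : P.coroot' (P.reflectionPerm i i) v = -P.coroot' i v := by
      simp [LinearMap.flip_apply]
    rw [h1, root_neg]
    have := h v
    simp only [map_neg, LinearMap.neg_apply]
    linarith
  · exact fun s hs v => stdForm_coroot_simple X n e hn he hs v
  · intro i s h hs v
    rw [root_reflectionPerm, stdForm_reflection X n e hn he hs, coroot'_reflectionPerm]
    have h1 := h (P.reflection s v)
    have h2 := stdForm_reflection X n e hn he hs v (P.reflection s (P.root i))
    rw [reflection_same] at h2
    rw [← h2]
    exact h1

/-- In type D, ε_0 is half the difference of two simple roots and so has height 0; each further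
simple root adds 1. -/
lemma heightFun_eps (hn : 1 ≤ n) (a : ℕ) (ha : a ≤ n) : heightFun b (eps X n e a) = a := by
  have hr := rank_le X n
  have hs : ∀ j, 1 ≤ j → j ≤ n → heightFun b (simpleRoot X n e j) = 1 := by
    intro j h1 h2
    have h := simpleRoot_eq X n e ⟨n - j, by omega⟩ (by simp)
    simp only [show n - (n - j) = j by omega] at h
    rw [h, heightFun_simple b (e _).2]
  induction a with
  | zero =>
    cases X with
    | B => simp [eps, Family.sq]
    | D =>
      have h := simpleRoot_eq .D n e ⟨n, by simp [Family.rank]⟩ le_rfl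
      simp only [Nat.sub_self] at h
      simp only [eps, map_add, map_smul, map_sub, hs 1 le_rfl hn, h, heightFun_simple b (e _).2]
      simp
  | succ a ih =>
    rw [eps_succ, map_add, ih (by omega), hs _ (by omega) ha]
    simp

end Realization

end HeightSubsystem

namespace HeightSubsystem

open RootPairing

/-! ### The Weyl group acts by signed permutations of the ε_a; list of all roots -/

section Realization

variable {ι V N : Type*} [Finite ι] [AddCommGroup V] [Module ℝ V] [AddCommGroup N] [Module ℝ N]
  {P : RootPairing ι ℝ V N} {b : P.Base} [P.IsRootSystem] [P.IsCrystallographic] [P.IsReduced]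
  (X : Family) (n : ℕ) (e : Fin (X.rank n) ≃ b.support)

lemma Family.sq_cases (X : Family) : X.sq = 0 ∨ X.sq = 1 := by cases X <;> simp [Family.sq]

omit [Finite ι] [P.IsReduced] in
/-- A simple reflection permutes the vectors `±ε_a`. -/
lemma reflection_eps (hn : 1 ≤ n) (he : ∀ x y, b.cartanMatrix (e x) (e y) = X.BD n x y) {s : ι}
    (hs : s ∈ b.support) : ∃ τ : Equiv.Perm ℕ, (∀ a ≤ n, τ a ≤ n) ∧
      ∀ a ≤ n, ∃ z : ℝ, (z = 1 ∨ z = -1) ∧ P.reflection s (eps X n e a) = z • eps X n e (τ a) := by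
  have hswap : ∀ j k : ℕ, j ≤ n → k ≤ n → ∀ a ≤ n, Equiv.swap j k a ≤ n := by
    intro j k hj hk a ha
    rw [Equiv.swap_apply_def]
    split_ifs <;> assumption
  have hform := stdForm_eps X n e hn
  have hco := stdForm_coroot_simple X n e hn he hs
  rcases simple_cases X n e hs with ⟨j, hj, hjn, hr⟩ | ⟨hX, hr⟩
  -- In this case α_1 = ε_1 is short, and its reflection changes the sign of ε_1 instead of
  -- exchanging two vectors.
  · by_cases hB : j = 1 ∧ X.sq = 0
    · obtain ⟨rfl, hX⟩ := hB
      have h0 := eps_zero_of_sq X n e hX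
      rw [Nat.sub_self, h0, sub_zero] at hr
      refine ⟨1, fun a ha => ha, fun a ha => ?_⟩
      have h1 := hco (eps X n e a)
      rw [hr, hform 1 1 hn hn, hform a 1 ha hn, if_pos rfl, if_neg one_ne_zero, mul_one] at h1
      rw [reflection_apply, h1, hr]
      by_cases ha1 : a = 1
      · refine ⟨-1, Or.inr rfl, ?_⟩
        subst ha1
        simp
        module
      · exact ⟨1, Or.inl rfl, by simp [ha1]⟩
    · refine ⟨Equiv.swap j (j - 1), hswap _ _ hjn (by omega), fun a ha => ⟨1, Or.inl rfl, ?_⟩⟩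
      have hw : (if j - 1 = 0 then X.sq else 1) = 1 := by
        split_ifs with h
        · rcases X.sq_cases with h1 | h1
          · exact absurd ⟨by omega, h1⟩ hB
          · exact h1
        · rfl
      have hN : stdForm X n e (P.root s) (P.root s) = 2 := by
        rw [hr]
        simp only [map_sub, LinearMap.sub_apply]
        rw [hform _ _ hjn hjn, hform _ _ (by omega) hjn, hform _ _ hjn (by omega),
          hform _ _ (by omega) (by omega), if_pos rfl, if_neg (by omega), if_neg (by omega),
          if_neg (by omega), if_pos rfl, hw]
        norm_num
      have h1 := hco (eps X n e a)
      rw [hN, hr, map_sub, hform _ _ ha hjn, hform _ _ ha (by omega)] at h1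
      have h2 : P.coroot' s (eps X n e a) =
          (if a = j then 1 else 0) - (if a = j - 1 then 1 else 0) := by
        have h3 : (if a = 0 then X.sq else 1) = 1 ∨ (a ≠ j ∧ a ≠ j - 1) := by
          by_cases h : a = j ∨ a = j - 1
          · left
            rcases h with rfl | rfl
            · rw [if_neg (by omega)]
            · exact hw
          · right; omega
        rcases h3 with h3 | h3
        · rw [h3] at h1
          linarith
        · rw [if_neg h3.1, if_neg h3.2] at h1 ⊢
          linarith
      rw [reflection_apply, h2, hr, Equiv.swap_apply_def, one_smul]
      by_cases h4 : a = j
      · subst h4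
        rw [if_pos rfl, if_neg (by omega), if_pos rfl]
        module
      · by_cases h5 : a = j - 1
        · subst h5
          rw [if_neg h4, if_pos rfl, if_neg h4, if_pos rfl]
          module
        · rw [if_neg h4, if_neg h5, if_neg h4, if_neg h5]
          module
  -- The reflection in ε_1 + ε_0 sends ε_1 to -ε_0 and ε_0 to -ε_1.
  · refine ⟨Equiv.swap 1 0, hswap _ _ hn (by omega), fun a ha => ?_⟩
    have hN : stdForm X n e (P.root s) (P.root s) = 2 := by
      rw [hr]
      simp only [map_add, LinearMap.add_apply]
      rw [hform _ _ hn hn, hform _ _ (by omega) hn, hform _ _ hn (by omega),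
        hform _ _ (by omega) (by omega), hX]
      norm_num
    have h1 := hco (eps X n e a)
    rw [hN, hr, map_add, hform _ _ ha hn, hform _ _ ha (by omega), hX, ite_self] at h1
    have h2 : P.coroot' s (eps X n e a) =
        (if a = 1 then 1 else 0) + (if a = 0 then 1 else 0) := by linarith
    rw [reflection_apply, h2, hr, Equiv.swap_apply_def]
    by_cases h4 : a = 1
    · refine ⟨-1, Or.inr rfl, ?_⟩
      subst h4
      simp
    · by_cases h5 : a = 0
      · refine ⟨-1, Or.inr rfl, ?_⟩
        subst h5
        simp
      · refine ⟨1, Or.inl rfl, ?_⟩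
        simp [h4, h5]

/-- Every root is of the form `±ε_c ± ε_a`. -/
lemma root_eq_eps (hn : 1 ≤ n) (he : ∀ x y, b.cartanMatrix (e x) (e y) = X.BD n x y) (i : ι) :
    ∃ a c : ℕ, ∃ x y : ℝ, a ≠ c ∧ a ≤ n ∧ c ≤ n ∧ (x = 1 ∨ x = -1) ∧ (y = 1 ∨ y = -1) ∧
      P.root i = x • eps X n e c + y • eps X n e a := by
  refine Base.induction_reflect (b := b) i (p := fun i => ∃ a c : ℕ, ∃ x y : ℝ, a ≠ c ∧ a ≤ n ∧
    c ≤ n ∧ (x = 1 ∨ x = -1) ∧ (y = 1 ∨ y = -1) ∧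
      P.root i = x • eps X n e c + y • eps X n e a) ?_ ?_ ?_
  · rintro i ⟨a, c, x, y, hac, ha, hc, hx, hy, h⟩
    refine ⟨a, c, -x, -y, hac, ha, hc, ?_, ?_, ?_⟩
    · rcases hx with rfl | rfl <;> simp
    · rcases hy with rfl | rfl <;> simp
    · rw [root_neg, h]
      module
  · intro s hs
    rcases simple_cases X n e hs with ⟨j, hj, hjn, hr⟩ | ⟨-, hr⟩
    · exact ⟨j - 1, j, 1, -1, by omega, by omega, hjn, by simp, by simp, by rw [hr]; module⟩
    · exact ⟨0, 1, 1, 1, by omega, by omega, hn, by simp, by simp, by rw [hr]; module⟩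
  · rintro i s ⟨a, c, x, y, hac, ha, hc, hx, hy, h⟩ hs
    obtain ⟨τ, hτ, hτ'⟩ := reflection_eps X n e hn he hs
    obtain ⟨z, hz, h1⟩ := hτ' a ha
    obtain ⟨w, hw, h2⟩ := hτ' c hc
    refine ⟨τ a, τ c, x * w, y * z, fun h => hac (τ.injective h), hτ a ha, hτ c hc, ?_, ?_, ?_⟩
    · rcases hx with rfl | rfl <;> rcases hw with rfl | rfl <;> simp
    · rcases hy with rfl | rfl <;> rcases hz with rfl | rfl <;> simp
    · rw [root_reflectionPerm, h, map_add, map_smul, map_smul, h1, h2, smul_smul, smul_smul]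

/-- The larger index decides the sign of the height, so its vector occurs with coefficient +1 in a
positive root. -/
lemma isPos_root_eq_eps (hn : 1 ≤ n) (he : ∀ x y, b.cartanMatrix (e x) (e y) = X.BD n x y) {i : ι}
    (hi : b.IsPos i) : ∃ a c, a < c ∧ c ≤ n ∧
      (P.root i = eps X n e c - eps X n e a ∨ P.root i = eps X n e c + eps X n e a) := by
  have key : ∀ a c : ℕ, ∀ x y : ℝ, a < c → c ≤ n → (x = 1 ∨ x = -1) → (y = 1 ∨ y = -1) →
      P.root i = x • eps X n e c + y • eps X n e a → ∃ a c, a < c ∧ c ≤ n ∧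
      (P.root i = eps X n e c - eps X n e a ∨ P.root i = eps X n e c + eps X n e a) := by
    intro a c x y hac hc hx hy h
    refine ⟨a, c, hac, hc, ?_⟩
    have h1 := heightFun_root b i
    have h2 : (0 : ℝ) < b.height i := by exact_mod_cast hi
    rw [← h1, h, map_add, map_smul, map_smul, heightFun_eps X n e hn c hc,
      heightFun_eps X n e hn a (by omega)] at h2
    have h3 : (a : ℝ) < c := by exact_mod_cast hac
    have h4 : (0 : ℝ) ≤ a := Nat.cast_nonneg a
    rcases hx with rfl | rfl
    · rcases hy with rfl | rfl
      · right; rw [h]; module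
      · left; rw [h]; module
    · exfalso
      rcases hy with rfl | rfl <;> simp only [smul_eq_mul] at h2 <;> linarith
  obtain ⟨a, c, x, y, hac, ha, hc, hx, hy, h⟩ := root_eq_eps X n e hn he i
  rcases lt_or_gt_of_ne hac with h1 | h1
  · exact key a c x y h1 hc hx hy h
  · exact key c a y x h1 ha hy hx (by rw [h, add_comm])

lemma exists_root_reflection (hn : 1 ≤ n)
    (he : ∀ x y, b.cartanMatrix (e x) (e y) = X.BD n x y) {i j : ι} {z : ℝ}
    (hj : stdForm X n e (P.root j) (P.root j) ≠ 0)
    (h : 2 * stdForm X n e (P.root i) (P.root j) = z * stdForm X n e (P.root j) (P.root j)) :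
    ∃ l, P.root l = P.root i - z • P.root j := by
  have h1 := stdForm_coroot X n e hn he j (P.root i)
  rw [h] at h1
  exact ⟨P.reflectionPerm j i, by
    rw [root_reflectionPerm, reflection_apply, mul_right_cancel₀ hj h1]⟩

lemma exists_root_sub (hn : 1 ≤ n) (he : ∀ x y, b.cartanMatrix (e x) (e y) = X.BD n x y)
    (a c : ℕ) (hac : a < c) (hc : c ≤ n) : ∃ i, P.root i = eps X n e c - eps X n e a := by
  have hr := rank_le X n
  have hs : ∀ j, 1 ≤ j → j ≤ n → ∃ i, P.root i = eps X n e j - eps X n e (j - 1) := by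
    intro j h1 h2
    have h := simpleRoot_eq X n e ⟨n - j, by omega⟩ (by simp)
    simp only [show n - (n - j) = j by omega] at h
    exact ⟨_, by rw [← h, simpleRoot_succ X n e j h1]⟩
  have hform := stdForm_eps X n e hn
  induction c, (show a + 1 ≤ c by omega) using Nat.le_induction with
  | base => simpa using hs (a + 1) (by omega) hc
  | succ c hac' ih =>
    obtain ⟨i, hi⟩ := ih (by omega) (by omega)
    obtain ⟨j, hj⟩ := hs (c + 1) (by omega) hc
    rw [Nat.add_sub_cancel] at hj
    have hN : stdForm X n e (P.root j) (P.root j) = 2 := by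
      rw [hj]
      simp only [map_sub, LinearMap.sub_apply]
      rw [hform _ _ (by omega) (by omega), hform _ _ (by omega) (by omega),
        hform _ _ (by omega) (by omega), hform _ _ (by omega) (by omega)]
      simp [show c ≠ 0 by omega]
      norm_num
    -- Reflecting ε_c - ε_a in ε_{c+1} - ε_c gives ε_{c+1} - ε_a.
    obtain ⟨l, hl⟩ := exists_root_reflection X n e hn he (i := i) (j := j) (z := -1)
      (by rw [hN]; norm_num) (by
        rw [hN, hi, hj]
        simp only [map_sub, LinearMap.sub_apply]
        rw [hform _ _ (by omega) (by omega), hform _ _ (by omega) (by omega),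
          hform _ _ (by omega) (by omega), hform _ _ (by omega) (by omega)]
        simp [show c ≠ 0 by omega, show a ≠ c by omega, show a ≠ c + 1 by omega])
    exact ⟨l, by rw [hl, hi, hj]; module⟩

lemma exists_root_add_zero (hn : 1 ≤ n) (he : ∀ x y, b.cartanMatrix (e x) (e y) = X.BD n x y)
    (hX : X.sq = 1) (c : ℕ) (hc0 : 1 ≤ c) (hc : c ≤ n) :
    ∃ i, P.root i = eps X n e c + eps X n e 0 := by
  have hform := stdForm_eps X n e hn
  induction c, hc0 using Nat.le_induction with
  | base =>
    have hD : n < X.rank n := by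
      cases X
      · simp [Family.sq] at hX
      · simp [Family.rank]
    have h := simpleRoot_eq X n e ⟨n, hD⟩ le_rfl
    simp only [Nat.sub_self] at h
    exact ⟨_, by rw [← h, simpleRoot_zero X n e hX]⟩
  | succ c hc1 ih =>
    obtain ⟨i, hi⟩ := ih (by omega)
    obtain ⟨j, hj⟩ := exists_root_sub X n e hn he c (c + 1) (by omega) hc
    have hN : stdForm X n e (P.root j) (P.root j) = 2 := by
      rw [hj]
      simp only [map_sub, LinearMap.sub_apply]
      rw [hform _ _ (by omega) (by omega), hform _ _ (by omega) (by omega),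
        hform _ _ (by omega) (by omega), hform _ _ (by omega) (by omega)]
      simp [show c ≠ 0 by omega]
      norm_num
    obtain ⟨l, hl⟩ := exists_root_reflection X n e hn he (i := i) (j := j) (z := -1)
      (by rw [hN]; norm_num) (by
        rw [hN, hi, hj]
        simp only [map_add, map_sub, LinearMap.add_apply]
        rw [hform _ _ (by omega) (by omega), hform _ _ (by omega) (by omega),
          hform _ _ (by omega) (by omega), hform _ _ (by omega) (by omega)]
        simp [show c ≠ 0 by omega, show 0 ≠ c by omega])
    exact ⟨l, by rw [hl, hi, hj]; module⟩

/-- For a > 0 the root arises by one reflection: of ε_c - ε_a in the short root ε_a in type B, of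
ε_c + ε_0 in ε_a - ε_0 in type D. -/
lemma exists_root_add (hn : 1 ≤ n) (he : ∀ x y, b.cartanMatrix (e x) (e y) = X.BD n x y)
    (a c : ℕ) (hac : a < c) (hc : c ≤ n) : ∃ i, P.root i = eps X n e c + eps X n e a := by
  have hform := stdForm_eps X n e hn
  rcases Nat.eq_zero_or_pos a with rfl | ha
  · rcases X.sq_cases with hX | hX
    · obtain ⟨i, hi⟩ := exists_root_sub X n e hn he 0 c hac hc
      refine ⟨i, ?_⟩
      rw [hi, eps_zero_of_sq X n e hX, sub_zero, add_zero]
    · exact exists_root_add_zero X n e hn he hX c hac hc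
  · obtain ⟨j, hj⟩ := exists_root_sub X n e hn he 0 a ha (by omega)
    rcases X.sq_cases with hX | hX
    · obtain ⟨i, hi⟩ := exists_root_sub X n e hn he a c hac hc
      rw [eps_zero_of_sq X n e hX, sub_zero] at hj
      have hN : stdForm X n e (P.root j) (P.root j) = 1 := by
        rw [hj, hform _ _ (by omega) (by omega)]
        simp [show a ≠ 0 by omega]
      obtain ⟨l, hl⟩ := exists_root_reflection X n e hn he (i := i) (j := j) (z := -2)
        (by rw [hN]; norm_num) (by
          rw [hN, hi, hj]
          simp only [map_sub, LinearMap.sub_apply]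
          rw [hform _ _ (by omega) (by omega), hform _ _ (by omega) (by omega)]
          simp [show c ≠ a by omega, show a ≠ 0 by omega])
      exact ⟨l, by rw [hl, hi, hj]; module⟩
    · obtain ⟨i, hi⟩ := exists_root_add_zero X n e hn he hX c (by omega) hc
      have hN : stdForm X n e (P.root j) (P.root j) = 2 := by
        rw [hj]
        simp only [map_sub, LinearMap.sub_apply]
        rw [hform _ _ (by omega) (by omega), hform _ _ (by omega) (by omega),
          hform _ _ (by omega) (by omega), hform _ _ (by omega) (by omega)]
        simp [show a ≠ 0 by omega, show 0 ≠ a by omega, hX]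
        norm_num
      obtain ⟨l, hl⟩ := exists_root_reflection X n e hn he (i := i) (j := j) (z := -1)
        (by rw [hN]; norm_num) (by
          rw [hN, hi, hj]
          simp only [map_add, map_sub, LinearMap.add_apply]
          rw [hform _ _ (by omega) (by omega), hform _ _ (by omega) (by omega),
            hform _ _ (by omega) (by omega), hform _ _ (by omega) (by omega)]
          simp [show a ≠ 0 by omega, show 0 ≠ a by omega, show c ≠ a by omega,
            show c ≠ 0 by omega, hX])
      exact ⟨l, by rw [hl, hi, hj]; module⟩

lemma realization (hn : 1 ≤ n) (he : ∀ x y, b.cartanMatrix (e x) (e y) = X.BD n x y) :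
    Realization X n e (eps X n e) (stdForm X n e) where
  form_eps := stdForm_eps X n e hn
  form_symm := stdForm_symm X n e
  pairing_mul i j := stdForm_coroot X n e hn he j (P.root i)
  height_eps := heightFun_eps X n e hn
  eps_zero := eps_zero_of_sq X n e
  simple_succ j hj _ := simpleRoot_succ X n e j hj
  simple_zero := simpleRoot_zero X n e
  exists_sub := exists_root_sub X n e hn he
  exists_add := exists_root_add X n e hn he
  pos_cases _ hi := isPos_root_eq_eps X n e hn he hi

end Realization

end HeightSubsystem

namespace HeightSubsystem

open RootPairing

/-! ### Determination of Γ(m) -/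

section SimpleRoots

variable {ι V N : Type*} [AddCommGroup V] [Module ℝ V] [AddCommGroup N] [Module ℝ N]
  {P : RootPairing ι ℝ V N} {b : P.Base}

/-- The vector `ε_a`, where `ε_{-a} = -ε_a` for `a > 0`. -/
def signed (ε : ℕ → V) (a : ℤ) : V := if 0 ≤ a then ε a.natAbs else -ε a.natAbs

omit [Module ℝ V] in
@[simp] lemma signed_natCast (ε : ℕ → V) (a : ℕ) : signed ε a = ε a := by simp [signed]

omit [Module ℝ V] in
lemma signed_neg (ε : ℕ → V) {a : ℤ} (ha : a ≠ 0) : signed ε (-a) = -signed ε a := by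
  unfold signed
  rw [Int.natAbs_neg]
  split_ifs <;> first | omega | simp

lemma exists_signed_eq (ε : ℕ → V) (a : ℤ) :
    ∃ x : ℝ, (x = 1 ∨ x = -1) ∧ (x : ℝ) * a.natAbs = a ∧ signed ε a = x • ε a.natAbs := by
  rcases le_or_gt 0 a with h | h
  · exact ⟨1, Or.inl rfl, by rw [one_mul, Nat.cast_natAbs, abs_of_nonneg h], by
      simp [signed, h]⟩
  · refine ⟨-1, Or.inr rfl, ?_, by simp [signed, not_le.2 h]⟩
    rw [Nat.cast_natAbs, abs_of_neg h]
    simp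

lemma two_mul_le_of_dvd {m h : ℤ} (hd : m ∣ h) (h0 : 0 < h) (hne : h ≠ m) (hm : 0 < m) :
    2 * m ≤ h := by
  obtain ⟨j, rfl⟩ := hd
  have h1 : 0 < j := by
    by_contra h1
    nlinarith [mul_nonneg hm.le (by omega : 0 ≤ -j)]
  have h2 : j ≠ 1 := by rintro rfl; simp at hne
  nlinarith [mul_le_mul_of_nonneg_left (by omega : 2 ≤ j) hm.le]

/-- All elements of R⁺(m) have height at least m, so a sum of two of them has height at least 2m. -/
lemma mem_simpleRootsMult_of_height {m : ℕ} (hm : 1 ≤ m) {i : ι} (hi : b.height i = m) :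
    i ∈ simpleRootsMult b m := by
  refine ⟨⟨by change (m : ℤ) ∣ _; rw [hi], by rw [Base.isPos_iff, hi]; omega⟩, ?_⟩
  rintro ⟨j, hj, l, hl, h⟩
  have hh := b.height_add h
  have h1 := Int.le_of_dvd hj.2 hj.1
  have h2 := Int.le_of_dvd hl.2 hl.1
  omega

variable [P.IsRootSystem] {X : Family} {n : ℕ} {e : Fin (X.rank n) ≃ b.support}
  {ε : ℕ → V} {g : V →ₗ[ℝ] V →ₗ[ℝ] ℝ}

namespace Realization

variable (hR : Realization X n e ε g)

include hR

lemma height_signed {a : ℤ} (ha : a.natAbs ≤ n) : heightFun b (signed ε a) = a := by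
  obtain ⟨x, -, hx, h⟩ := exists_signed_eq ε a
  rw [h, map_smul, hR.height_eps _ ha, smul_eq_mul, hx]

lemma form_signed_of_ne {a c : ℤ} (ha : a.natAbs ≤ n) (hc : c.natAbs ≤ n)
    (hac : a.natAbs ≠ c.natAbs) : g (signed ε a) (signed ε c) = 0 := by
  obtain ⟨x, -, -, h⟩ := exists_signed_eq ε a
  obtain ⟨y, -, -, h'⟩ := exists_signed_eq ε c
  rw [h, h', map_smul, map_smul, LinearMap.smul_apply, hR.form_eps _ _ ha hc, if_neg hac]
  simp

lemma form_signed_self {a : ℤ} (ha : a.natAbs ≤ n) (ha0 : a ≠ 0) :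
    g (signed ε a) (signed ε a) = 1 := by
  obtain ⟨x, hx, -, h⟩ := exists_signed_eq ε a
  rw [h, map_smul, map_smul, LinearMap.smul_apply, hR.form_eps _ _ ha ha, if_pos rfl,
    if_neg (by omega)]
  rcases hx with rfl | rfl <;> simp

lemma exists_root_smul_add {a c : ℕ} (ha : a ≤ n) (hc : c ≤ n) (hac : a ≠ c) {x y : ℝ}
    (hx : x = 1 ∨ x = -1) (hy : y = 1 ∨ y = -1) : ∃ i, P.root i = x • ε a + y • ε c := by
  have key : ∀ a c : ℕ, a < c → c ≤ n → ∀ x y : ℝ, (x = 1 ∨ x = -1) → (y = 1 ∨ y = -1) →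
      ∃ i, P.root i = x • ε a + y • ε c := by
    intro a c hac hc x y hx hy
    obtain ⟨i, hi⟩ := hR.exists_sub a c hac hc
    obtain ⟨j, hj⟩ := hR.exists_add a c hac hc
    rcases hx with rfl | rfl <;> rcases hy with rfl | rfl
    · exact ⟨j, by rw [hj]; module⟩
    · exact ⟨P.reflectionPerm i i, by rw [root_neg, hi]; module⟩
    · exact ⟨i, by rw [hi]; module⟩
    · exact ⟨P.reflectionPerm j j, by rw [root_neg, hj]; module⟩
  rcases lt_or_gt_of_ne hac with h | h
  · exact key a c h hc x y hx hy
  · obtain ⟨i, hi⟩ := key c a h ha y x hy hx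
    exact ⟨i, by rw [hi, add_comm]⟩

lemma exists_root_signed {a c : ℤ} (ha : a.natAbs ≤ n) (hc : c.natAbs ≤ n)
    (hac : a.natAbs ≠ c.natAbs) : ∃ i, P.root i = signed ε a - signed ε c := by
  obtain ⟨x, hx, -, h⟩ := exists_signed_eq ε a
  obtain ⟨y, hy, -, h'⟩ := exists_signed_eq ε c
  obtain ⟨i, hi⟩ := hR.exists_root_smul_add ha hc hac hx (y := -y)
    (by rcases hy with rfl | rfl <;> simp)
  exact ⟨i, by rw [hi, h, h']; module⟩

lemma height_of_root_eq_sub {i : ι} {a c : ℤ} (ha : a.natAbs ≤ n) (hc : c.natAbs ≤ n)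
    (h : P.root i = signed ε a - signed ε c) : b.height i = a - c := by
  have h1 := heightFun_root b i
  rw [h, map_sub, hR.height_signed ha, hR.height_signed hc] at h1
  exact_mod_cast h1.symm

lemma height_of_root_eq_add {i : ι} {a c : ℕ} (ha : a ≤ n) (hc : c ≤ n)
    (h : P.root i = ε a + ε c) : b.height i = a + c := by
  have h1 := heightFun_root b i
  rw [h, map_add, hR.height_eps _ ha, hR.height_eps _ hc] at h1
  exact_mod_cast h1.symm

/-- Split ε_a - ε_c at ε_x. The conditions on absolute values are what makes both pieces roots. -/
lemma notMem_simpleRootsMult {m : ℕ} {i : ι} {a c x : ℤ} (ha : a.natAbs ≤ n)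
    (hc : c.natAbs ≤ n) (hx : x.natAbs ≤ n) (hax : a.natAbs ≠ x.natAbs)
    (hcx : x.natAbs ≠ c.natAbs) (h1 : (m : ℤ) ∣ a - x) (h2 : (m : ℤ) ∣ x - c)
    (h3 : x < a) (h4 : c < x) (h : P.root i = signed ε a - signed ε c) :
    i ∉ simpleRootsMult b m := by
  obtain ⟨j, hj⟩ := hR.exists_root_signed ha hx hax
  obtain ⟨l, hl⟩ := hR.exists_root_signed hx hc hcx
  have hj' := hR.height_of_root_eq_sub ha hx hj
  have hl' := hR.height_of_root_eq_sub hx hc hl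
  intro hi
  refine hi.2 ⟨j, ⟨by change (m : ℤ) ∣ _; rwa [hj'], by rw [Base.isPos_iff, hj']; omega⟩, l,
    ⟨by change (m : ℤ) ∣ _; rwa [hl'], by rw [Base.isPos_iff, hl']; omega⟩, ?_⟩
  rw [h, hj, hl]
  abel

lemma simpleRootsMult_cases {m : ℕ} (hm : 1 ≤ m) {i : ι} (hi : i ∈ simpleRootsMult b m) :
    b.height i = m ∨ ∃ k, m = 2 * k ∧ 3 * k ≤ n ∧ P.root i = ε (3 * k) + ε k := by
  by_cases hh : b.height i = m
  · exact Or.inl hh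
  right
  have hdvd : (m : ℤ) ∣ b.height i := hi.1.1
  have hm2 := two_mul_le_of_dvd hdvd hi.1.2 hh (by omega)
  have key : ∀ (c : ℕ) (a : ℤ), c ≤ n → a.natAbs < c → P.root i = signed ε c - signed ε a →
      ∃ k, m = 2 * k ∧ 3 * k ≤ n ∧ P.root i = ε (3 * k) + ε k := by
    intro c a hc hac h
    have hht := hR.height_of_root_eq_sub (by simpa using hc) (by omega) h
    rw [hht] at hdvd hm2
    have hd : ∀ x : ℤ, x = c - m ∨ x = a + m → (m : ℤ) ∣ c - x ∧ (m : ℤ) ∣ x - a := by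
      rintro x (rfl | rfl)
      · exact ⟨by simp, by
          rw [show (c : ℤ) - m - a = c - a - m by ring]; exact dvd_sub hdvd dvd_rfl⟩
      · exact ⟨by
          rw [show (c : ℤ) - (a + m) = c - a - m by ring]; exact dvd_sub hdvd dvd_rfl, by simp⟩
    -- Split off height m at the upper end (x = c - m) or at the lower end (x = a + m). Both are
    -- blocked only if c - m = -a and a + m = -a, that is, a = -k, c = 3k and m = 2k.
    by_cases h1 : (c - m : ℤ).natAbs = a.natAbs
    · by_cases h2 : (a + m : ℤ).natAbs = a.natAbs
      · refine ⟨a.natAbs, by omega, by omega, ?_⟩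
        rw [h, signed_natCast, show c = 3 * a.natAbs by omega, signed, if_neg (by omega)]
        simp
      · exact absurd hi (hR.notMem_simpleRootsMult (x := a + m) (by simpa using hc) (by omega)
          (by omega) (by omega) h2 (hd _ (Or.inr rfl)).1 (hd _ (Or.inr rfl)).2 (by omega)
          (by omega) h)
    · exact absurd hi (hR.notMem_simpleRootsMult (x := c - m) (by simpa using hc) (by omega)
          (by omega) (by omega) h1 (hd _ (Or.inl rfl)).1 (hd _ (Or.inl rfl)).2 (by omega)
          (by omega) h)
  obtain ⟨a, c, hac, hc, h | h⟩ := hR.pos_cases i hi.1.2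
  · exact key c a hc (by simpa using hac) (by simpa using h)
  · rcases Nat.eq_zero_or_pos a with rfl | ha
    -- The convention for negative indices does not reach -ε_0, so ε_c + ε_0 is split by hand as
    -- (ε_c - ε_{c-m}) + (ε_{c-m} + ε_0).
    · exfalso
      have hht := hR.height_of_root_eq_add hc (by omega) h
      rw [hht] at hdvd hm2
      simp only [Nat.cast_zero, add_zero] at hdvd hm2
      obtain ⟨j, hj⟩ := hR.exists_sub (c - m) c (by omega) hc
      obtain ⟨l, hl⟩ := hR.exists_add 0 (c - m) (by omega) (by omega)
      have hj' := hR.height_of_root_eq_sub (a := c) (c := (c - m : ℕ)) (by simpa using hc)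
        (by omega) (by simpa using hj)
      have hl' := hR.height_of_root_eq_add (a := c - m) (c := 0) (by omega) (by omega) hl
      have h3 : ((c - m : ℕ) : ℤ) = c - m := by omega
      rw [h3] at hj' hl'
      refine hi.2 ⟨j, ⟨by change (m : ℤ) ∣ _; rw [hj']; simp, by rw [Base.isPos_iff, hj']; omega⟩, l,
        ⟨by change (m : ℤ) ∣ _; rw [hl']; simpa using dvd_sub hdvd dvd_rfl, by
          rw [Base.isPos_iff, hl']; omega⟩, ?_⟩
      rw [h, hj, hl]
      abel
    · refine key c (-a) hc (by simpa using hac) ?_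
      rw [h, signed_neg ε (by omega)]
      simp

/-- In a root of height 2k, ε_{3k} occurs with sign + only in ε_{3k} - ε_k, which is orthogonal to
δ; ε_k cannot occur with sign +, since its partner would have to be ε_k again. -/
lemma form_delta_nonpos {k : ℕ} (hk : 1 ≤ k) (hkn : 3 * k ≤ n) {i : ι}
    (hi : b.height i = (2 * k : ℕ)) : g (ε (3 * k) + ε k) (P.root i) ≤ 0 := by
  have hpos : b.IsPos i := by rw [Base.isPos_iff, hi]; omega
  obtain ⟨a, c, hac, hc, h | h⟩ := hR.pos_cases i hpos
  · have hht := hR.height_of_root_eq_sub (a := c) (c := a) (by simpa using hc) (by simp; omega)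
      (by simpa using h)
    rw [h]
    simp only [map_add, map_sub, LinearMap.add_apply]
    rw [hR.form_eps _ _ hkn hc, hR.form_eps _ _ (by omega) hc, hR.form_eps _ _ hkn (by omega),
      hR.form_eps _ _ (by omega) (by omega)]
    split_ifs <;> first | omega | norm_num
  · have hht := hR.height_of_root_eq_add hc (by omega) h
    rw [h]
    simp only [map_add, LinearMap.add_apply]
    rw [hR.form_eps _ _ hkn hc, hR.form_eps _ _ (by omega) hc, hR.form_eps _ _ hkn (by omega),
      hR.form_eps _ _ (by omega) (by omega)]
    split_ifs <;> first | omega | norm_num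

/-- As δ has height 2m, two summands in R⁺(m) would both have height m. By `form_delta_nonpos` the
square of δ would then be nonpositive, whereas it is 2. -/
lemma delta_mem_simpleRootsMult {k : ℕ} (hk : 1 ≤ k) (hkn : 3 * k ≤ n) {i : ι}
    (hi : P.root i = ε (3 * k) + ε k) : i ∈ simpleRootsMult b (2 * k) := by
  have hht := hR.height_of_root_eq_add hkn (by omega) hi
  refine ⟨⟨⟨2, by rw [hht]; push_cast; ring⟩, by rw [Base.isPos_iff, hht]; omega⟩, ?_⟩
  rintro ⟨j, hj, l, hl, h⟩
  have hh := b.height_add h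
  have h1 := Int.le_of_dvd hj.2 hj.1
  have h2 := Int.le_of_dvd hl.2 hl.1
  have h3 := hR.form_delta_nonpos hk hkn (i := j) (by push_cast at *; omega)
  have h4 := hR.form_delta_nonpos hk hkn (i := l) (by push_cast at *; omega)
  have h5 : g (ε (3 * k) + ε k) (P.root i) = 2 := by
    rw [hi]
    simp only [map_add, LinearMap.add_apply]
    rw [hR.form_eps _ _ hkn hkn, hR.form_eps _ _ (by omega) hkn, hR.form_eps _ _ hkn (by omega),
      hR.form_eps _ _ (by omega) (by omega)]
    simp (disch := omega) only [if_true, if_neg]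
    norm_num
  rw [h, map_add] at h5
  linarith

end Realization

end SimpleRoots

end HeightSubsystem

namespace HeightSubsystem

open RootPairing

/-! ### Residue classes modulo m and the chains of roots of height m they carry -/

section Diagrams

variable {ι V N : Type*} [AddCommGroup V] [Module ℝ V] [AddCommGroup N] [Module ℝ N]
  {P : RootPairing ι ℝ V N} {b : P.Base}

/-- The elements of `[-n, n]` congruent to `r` modulo `m`, where `0 < r < m / 2`, are the integers
`r + d * m` with `-l ≤ d ≤ p`. -/
structure ResidueChain (n m r l p : ℕ) : Prop where
  pos : 0 < r
  two_mul_lt : 2 * r < m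
  lower : l * m ≤ n + r
  lower' : n + r < (l + 1) * m
  upper : r + p * m ≤ n
  upper' : n < r + (p + 1) * m

/-- The unit vectors `ε_a` with `a` congruent to `r` modulo `m`. -/
def resVec (ε : ℕ → V) (m r l : ℕ) (j : ℕ) : V := signed ε ((r : ℤ) + ((j : ℤ) - l) * m)

lemma ResidueChain.natAbs_le {n m r l p : ℕ} (h : ResidueChain n m r l p) {j : ℕ}
    (hj : j ≤ l + p) : ((r : ℤ) + ((j : ℤ) - l) * m).natAbs ≤ n := by
  have h1 := h.lower
  have h2 := h.upper
  zify at h1 h2 hj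
  have h3 : (j : ℤ) * m ≤ (l + p) * m := mul_le_mul_of_nonneg_right hj (by positivity)
  have h4 : (0 : ℤ) ≤ (j : ℤ) * m := by positivity
  have h5 : ((j : ℤ) - l) * m = j * m - l * m := by ring
  have h6 : ((l : ℤ) + p) * m = l * m + p * m := by ring
  rw [h5]
  omega

/-- Since 0 < 2r < m, the class of r contains no two opposite integers. This is why the class
carries a diagram of type A. -/
lemma ResidueChain.natAbs_ne {n m r l p : ℕ} (h : ResidueChain n m r l p) {i j : ℤ}
    (hij : i ≠ j) : ((r : ℤ) + i * m).natAbs ≠ ((r : ℤ) + j * m).natAbs := by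
  intro h1
  have hm : (0 : ℤ) < m := by have := h.two_mul_lt; omega
  rcases Int.natAbs_eq_natAbs_iff.1 h1 with h2 | h2
  · exact hij (mul_right_cancel₀ hm.ne' (by linarith))
  · have h3 : (m : ℤ) ∣ 2 * r := ⟨-(i + j), by linarith⟩
    have := Int.le_of_dvd (by have := h.pos; omega) h3
    have := h.two_mul_lt
    omega

/-- The span of the `ε_a` with `a` congruent to `±r` modulo `m`. -/
def classSpan (ε : ℕ → V) (n m r : ℕ) : Submodule ℝ V :=
  Submodule.span ℝ (ε '' {a | a ≤ n ∧ ((m : ℤ) ∣ a - r ∨ (m : ℤ) ∣ a + r)})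

lemma eps_mem_classSpan (ε : ℕ → V) {n m r a : ℕ} (ha : a ≤ n) (h : (m : ℤ) ∣ a - r) :
    ε a ∈ classSpan ε n m r := Submodule.subset_span ⟨a, ⟨ha, Or.inl h⟩, rfl⟩

lemma signed_mem_classSpan (ε : ℕ → V) {n m r : ℕ} {a : ℤ} (ha : a.natAbs ≤ n)
    (h : (m : ℤ) ∣ a - r) : signed ε a ∈ classSpan ε n m r := by
  obtain ⟨x, -, -, hx⟩ := exists_signed_eq ε a
  rw [hx]
  refine Submodule.smul_mem _ _ (Submodule.subset_span ⟨_, ⟨ha, ?_⟩, rfl⟩)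
  rcases Int.natAbs_eq a with h1 | h1
  · left; rwa [← h1]
  · right
    rw [show ((a.natAbs : ℤ)) = -a by omega]
    rw [show -a + r = -(a - r) by ring]
    exact (dvd_neg).2 h

lemma stepVec_mem_classSpan (ε : ℕ → V) {n m r l p : ℕ} (h : ResidueChain n m r l p)
    (x : Fin (l + p)) : stepVec (resVec ε m r l) (l + p) x ∈ classSpan ε n m r :=
  sub_mem (signed_mem_classSpan ε (h.natAbs_le (by omega)) (by simp))
    (signed_mem_classSpan ε (h.natAbs_le (by omega)) (by simp))

lemma chainVec_mem_classSpan (X : Family) (ε : ℕ → V) {n m r q : ℕ} (hq : 1 ≤ q)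
    (hn : r + q * m ≤ n) (x : Fin (X.rank q)) :
    chainVec X (fun c => ε (r + c * m)) q x ∈ classSpan ε n m r := by
  have key : ∀ c ≤ q, ε (r + c * m) ∈ classSpan ε n m r := fun c hc =>
    eps_mem_classSpan ε ((by gcongr : r + c * m ≤ r + q * m).trans hn) (by simp)
  unfold chainVec
  split_ifs
  · exact add_mem (key _ hq) (key _ (by omega))
  · exact sub_mem (key _ (by omega)) (key _ (by omega))

variable [P.IsRootSystem] {X : Family} {n : ℕ} {e : Fin (X.rank n) ≃ b.support}
  {ε : ℕ → V} {g : V →ₗ[ℝ] V →ₗ[ℝ] ℝ}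

namespace Realization

variable (hR : Realization X n e ε g)

include hR

lemma form_root_pos (i : ι) : 0 < g (P.root i) (P.root i) := by
  have key : ∀ i, b.IsPos i → 0 < g (P.root i) (P.root i) := by
    intro i hi
    have hsq : 0 ≤ X.sq := by rcases X.sq_cases with h | h <;> rw [h]; norm_num
    obtain ⟨a, c, hac, hc, h | h⟩ := hR.pos_cases i hi <;> rw [h] <;>
    · simp only [map_add, map_sub, LinearMap.add_apply, LinearMap.sub_apply]
      rw [hR.form_eps _ _ hc hc, hR.form_eps _ _ hc (by omega), hR.form_eps _ _ (by omega) hc,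
        hR.form_eps _ _ (by omega) (by omega), if_pos rfl, if_pos rfl, if_neg (by omega),
        if_neg (by omega), if_neg (by omega)]
      split_ifs <;> linarith
  rcases Base.IsPos.or_neg b i with h | h
  · exact key i h
  · have h1 := key _ h
    change 0 < g (P.root (P.reflectionPerm i i)) (P.root (P.reflectionPerm i i)) at h1
    rw [root_neg] at h1
    simpa using h1

lemma hasDiagram_of_represents [P.IsCrystallographic] {κ : Type} {v : κ → V} {A : Matrix κ κ ℤ}
    {S : Set ι} (hv : Represents g v A) (hA : OffDiagNonpos A) (hS : P.root '' S = Set.range v) :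
    HasDiagram P S A := by
  have h1 : ∀ x, ∃ i ∈ S, P.root i = v x := fun x => by
    have : v x ∈ P.root '' S := hS ▸ ⟨x, rfl⟩
    obtain ⟨i, hi, h⟩ := this
    exact ⟨i, hi, h⟩
  choose f hfS hf using h1
  have hpos : ∀ x, 0 < g (v x) (v x) := fun x => hf x ▸ hR.form_root_pos (f x)
  -- Distinct indices with the same vector would have Cartan entry 2, against `hA`.
  have hinj : Function.Injective v := by
    intro x y hxy
    by_contra hne
    have h2 := hv x y
    rw [hxy] at h2
    have h3 : (A x y : ℝ) = 2 := (mul_right_cancel₀ (hpos y).ne' h2).symm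
    have h4 := hA x y hne
    have h5 : A x y = 2 := by exact_mod_cast h3
    omega
  refine ⟨Equiv.ofBijective (fun x => ⟨f x, hfS x⟩) ⟨fun x y hxy => ?_, fun i => ?_⟩,
    fun x y => ?_⟩
  · have h2 : f x = f y := congrArg Subtype.val hxy
    exact hinj (by rw [← hf, ← hf, h2])
  · obtain ⟨x, hx⟩ : P.root i ∈ Set.range v := hS ▸ ⟨i, i.2, rfl⟩
    exact ⟨x, Subtype.ext (P.root.injective (by rw [hf, hx]))⟩
  · have h2 := hR.pairing_mul (f x) (f y)
    rw [hf, hf, hv x y, pairing_eq_pairingIn] at h2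
    exact_mod_cast mul_right_cancel₀ (hpos y).ne' h2

/-- Classes with distinct representatives in [0, m/2] are distinct even up to sign, so the two spans
involve disjoint sets of the orthogonal vectors ε_a. -/
lemma form_eq_zero_of_mem_classSpan {m r r' : ℕ} (hr : 2 * r ≤ m) (hr' : 2 * r' ≤ m)
    (hne : r ≠ r') {v w : V} (hv : v ∈ classSpan ε n m r) (hw : w ∈ classSpan ε n m r') :
    g v w = 0 := by
  have h1 : classSpan ε n m r ≤ LinearMap.ker (g.flip w) := by
    refine Submodule.span_le.2 ?_
    rintro _ ⟨a, ⟨ha, ha'⟩, rfl⟩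
    change g (ε a) w = 0
    have h2 : classSpan ε n m r' ≤ LinearMap.ker (g (ε a)) := by
      refine Submodule.span_le.2 ?_
      rintro _ ⟨c, ⟨hc, hc'⟩, rfl⟩
      change g (ε a) (ε c) = 0
      rw [hR.form_eps _ _ ha hc, if_neg]
      rintro rfl
      have h3 : (m : ℤ) ∣ r - r' ∨ (m : ℤ) ∣ r + r' := by
        rcases ha' with ha' | ha' <;> rcases hc' with hc' | hc'
        · left; have := dvd_sub hc' ha'; rwa [show (a : ℤ) - r' - (a - r) = r - r' by ring] at this
        · right; have := dvd_sub hc' ha'; rwa [show (a : ℤ) + r' - (a - r) = r + r' by ring] at this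
        · right; have := dvd_sub ha' hc'; rwa [show (a : ℤ) + r - (a - r') = r + r' by ring] at this
        · left; have := dvd_sub ha' hc'; rwa [show (a : ℤ) + r - (a + r') = r - r' by ring] at this
      rcases h3 with h3 | h3
      · obtain ⟨j, hj⟩ := h3
        have hm : (0 : ℤ) < m := by omega
        have h4 : j = 0 := by
          by_contra h5
          rcases lt_or_gt_of_ne h5 with h6 | h6
          · nlinarith
          · nlinarith
        rw [h4] at hj
        omega
      · have := Int.le_of_dvd (by omega) h3
        omega
    exact h2 hw
  exact h1 hv

lemma represents_stepVec_resVec {m r l p : ℕ} (h : ResidueChain n m r l p) :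
    Represents g (stepVec (resVec ε m r l) (l + p)) (typeA (l + p)) := by
  refine represents_stepVec g _ _ fun i j hi hj => ?_
  have hi' := h.natAbs_le hi
  have hj' := h.natAbs_le hj
  by_cases hij : i = j
  · subst hij
    rw [if_pos rfl]
    refine hR.form_signed_self hi' fun h0 => ?_
    have h1 : (m : ℤ) ∣ r := ⟨-(i - l), by linarith⟩
    have := Int.le_of_dvd (by have := h.pos; omega) h1
    have := h.two_mul_lt
    omega
  · rw [if_neg hij]
    exact hR.form_signed_of_ne hi' hj' (h.natAbs_ne (by omega))

lemma exists_root_stepVec {m r l p : ℕ} (h : ResidueChain n m r l p) (x : Fin (l + p)) :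
    ∃ i, b.height i = m ∧ P.root i = stepVec (resVec ε m r l) (l + p) x := by
  have h1 := h.natAbs_le (j := x + 1) (by omega)
  have h2 := h.natAbs_le (j := x) (by omega)
  obtain ⟨i, hi⟩ := hR.exists_root_signed h1 h2 (h.natAbs_ne (by push_cast; omega))
  refine ⟨i, ?_, hi⟩
  rw [hR.height_of_root_eq_sub h1 h2 hi]
  push_cast
  ring

omit hR in
omit [Module ℝ V] [P.IsRootSystem] in
lemma exists_stepVec_eq {m r l p : ℕ} (h : ResidueChain n m r l p) {a : ℤ}
    (hd : (m : ℤ) ∣ a - r) (h1 : -(n : ℤ) ≤ a) (h2 : a + m ≤ n) :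
    ∃ x, stepVec (resVec ε m r l) (l + p) x = signed ε (a + m) - signed ε a := by
  obtain ⟨d, hd⟩ := hd
  have hm : (0 : ℤ) < m := by have := h.two_mul_lt; omega
  have h3 := h.lower'
  have h4 := h.upper'
  zify at h3 h4
  have h5 : -(l : ℤ) ≤ d := by
    by_contra h6
    have : (m : ℤ) * d ≤ m * (-l - 1) := mul_le_mul_of_nonneg_left (by omega) hm.le
    linarith
  have h6 : d < p := by
    by_contra h6
    have : (m : ℤ) * p ≤ m * d := mul_le_mul_of_nonneg_left (by omega) hm.le
    linarith
  refine ⟨⟨(d + l).toNat, by omega⟩, ?_⟩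
  simp only [stepVec, resVec]
  push_cast
  rw [Int.toNat_of_nonneg (by omega)]
  congr 2 <;> linear_combination -hd

lemma represents_chainVec_zero {m q : ℕ} (hm : 1 ≤ m) (hq : 1 ≤ q) (hn : q * m ≤ n) :
    Represents g (chainVec X (fun c => ε (0 + c * m)) q) (X.BD q) := by
  refine represents_chainVec X g _ q hq fun a c ha hc => ?_
  rw [hR.form_eps _ _ (by rw [zero_add]; exact le_trans (by gcongr) hn)
    (by rw [zero_add]; exact le_trans (by gcongr) hn)]
  simp [show m ≠ 0 by omega]

/-- Here ε_k plays the part of ε_0. Unlike ε_0 it has length 1 in both families, so the diagram is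
of type D even if R is of type B. -/
lemma represents_chainVec_half {m k p : ℕ} (hm : 1 ≤ m) (hk : 1 ≤ k) (hp : 1 ≤ p)
    (hn : k + p * m ≤ n) :
    Represents g (chainVec .D (fun c => ε (k + c * m)) p) (typeD (p + 1)) := by
  refine represents_chainVec .D g _ p hp fun a c ha hc => ?_
  rw [hR.form_eps _ _ (le_trans (by gcongr) hn) (le_trans (by gcongr) hn)]
  simp [show m ≠ 0 by omega, show k ≠ 0 by omega, Family.sq]

lemma exists_root_sub_height {m r c : ℕ} (hm : 1 ≤ m) (hn : r + (c + 1) * m ≤ n) :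
    ∃ i, b.height i = m ∧ P.root i = ε (r + (c + 1) * m) - ε (r + c * m) := by
  have h1 : r + c * m + m ≤ n := by linarith
  have h2 : r + (c + 1) * m = r + c * m + m := by ring
  rw [h2]
  obtain ⟨i, hi⟩ := hR.exists_sub (r + c * m) (r + c * m + m) (by omega) h1
  refine ⟨i, ?_, hi⟩
  have := hR.height_of_root_eq_sub (a := (r + c * m + m : ℕ)) (c := (r + c * m : ℕ))
    (by rw [Int.natAbs_natCast]; exact h1) (by rw [Int.natAbs_natCast]; omega)
    (by simpa only [signed_natCast] using hi)
  rw [this]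
  push_cast
  ring

lemma exists_root_chainVec_zero {m q : ℕ} (hm : 1 ≤ m) (hq : 1 ≤ q) (hn : q * m ≤ n)
    (x : Fin (X.rank q)) :
    ∃ i, b.height i = m ∧ P.root i = chainVec X (fun c => ε (0 + c * m)) q x := by
  unfold chainVec
  split_ifs with h
  · have h1 : m ≤ n := le_trans (by nlinarith) hn
    obtain ⟨i, hi⟩ := hR.exists_add 0 m (by omega) h1
    refine ⟨i, ?_, by simpa using hi⟩
    simpa using hR.height_of_root_eq_add h1 (by omega) hi
  · have hr := rank_le X q
    have hx := x.2
    have hqx : q - (x : ℕ) = q - x - 1 + 1 := by omega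
    have h1 : 0 + (q - x - 1 + 1) * m ≤ n := by
      rw [← hqx, zero_add]
      exact le_trans (by gcongr; omega) hn
    have := hR.exists_root_sub_height hm h1
    rwa [← hqx] at this

lemma exists_chainVec_zero_eq {m q t : ℕ} (hnq : n = q * m + t)
    (ht : t < m) {i : ι} {a : ℕ} (ha : m ∣ a) (han : a + m ≤ n)
    (hi : P.root i = ε (a + m) - ε a ∨ (a = 0 ∧ P.root i = ε (a + m) + ε a)) :
    ∃ x, P.root i = chainVec X (fun c => ε (0 + c * m)) q x := by
  have hr := rank_le X q
  obtain ⟨d, rfl⟩ := ha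
  have hd : d + 1 ≤ q := by
    by_contra h
    have : (q + 1) * m ≤ (d + 1) * m := Nat.mul_le_mul_right m (by omega)
    nlinarith
  have key : P.root i = ε (m * d + m) - ε (m * d) →
      ∃ x, P.root i = chainVec X (fun c => ε (0 + c * m)) q x := by
    intro h
    refine ⟨⟨q - 1 - d, by omega⟩, ?_⟩
    rw [chainVec, if_neg (by simp only; omega), h]
    simp only
    rw [show q - (q - 1 - d) = d + 1 by omega, Nat.add_sub_cancel]
    congr 2 <;> ring
  rcases hi with hi | ⟨h0, hi⟩
  · exact key hi
  · rcases X.sq_cases with hX | hX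
    -- In type B, ε_m + ε_0 and ε_m - ε_0 are the same root, already present in the chain.
    · refine key ?_
      rw [hi, h0, hR.eps_zero hX]
      simp
    · have hD : q < X.rank q := by
        cases X
        · simp [Family.sq] at hX
        · simp [Family.rank]
      refine ⟨⟨q, hD⟩, ?_⟩
      rw [chainVec, if_pos rfl, hi, h0]
      simp

end Realization

end Diagrams

end HeightSubsystem

/-! ### All roots of height m, sorted by residue class -/

namespace HeightSubsystem

open RootPairing

/-- A set of `c` residue classes `r, …, r + c - 1`, each with a chain of `l + p` steps. -/
structure ResidueGroup where
  /-- the first residue class -/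
  r : ℕ
  /-- the number of steps below the representative -/
  l : ℕ
  /-- the number of steps above the representative -/
  p : ℕ
  /-- the number of residue classes -/
  c : ℕ

/-- The residue classes of `G` and `H` are all the residue classes modulo `m`, up to sign and
except for `0` and `m / 2`. -/
structure ResidueCover (n m : ℕ) (G H : ResidueGroup) : Prop where
  chain_left : ∀ s < G.c, ResidueChain n m (G.r + s) G.l G.p
  chain_right : ∀ s < H.c, ResidueChain n m (H.r + s) H.l H.p
  disj : ∀ s < G.c, ∀ s' < H.c, G.r + s ≠ H.r + s'
  cover : ∀ r, 0 < r → 2 * r < m → (∃ s < G.c, r = G.r + s) ∨ ∃ s < H.c, r = H.r + s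

section Diagrams

variable {ι V N : Type*} [AddCommGroup V] [Module ℝ V] [AddCommGroup N] [Module ℝ N]
  {P : RootPairing ι ℝ V N} {b : P.Base}

/-- The differences of consecutive unit vectors in the residue classes of `G`. -/
def groupVec (ε : ℕ → V) (m : ℕ) (G : ResidueGroup) (z : Fin (G.l + G.p) × Fin G.c) : V :=
  stepVec (resVec ε m (G.r + z.2) G.l) (G.l + G.p) z.1

/-- The roots of height `m` outside the residue class `m / 2`. -/
def restVec (X : Family) (ε : ℕ → V) (m q : ℕ) (G H : ResidueGroup) :
    (Fin (X.rank q) ⊕ Fin (G.l + G.p) × Fin G.c) ⊕ Fin (H.l + H.p) × Fin H.c → V :=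
  Sum.elim (Sum.elim (chainVec X (fun c => ε (0 + c * m)) q) (groupVec ε m G)) (groupVec ε m H)

/-- The Cartan matrix of the vectors `restVec`. -/
def restMatrix (X : Family) (q : ℕ) (G H : ResidueGroup) :
    Matrix ((Fin (X.rank q) ⊕ Fin (G.l + G.p) × Fin G.c) ⊕ Fin (H.l + H.p) × Fin H.c)
      ((Fin (X.rank q) ⊕ Fin (G.l + G.p) × Fin G.c) ⊕ Fin (H.l + H.p) × Fin H.c) ℤ :=
  X.BD q ⊕ᴅ copies G.c (typeA (G.l + G.p)) ⊕ᴅ copies H.c (typeA (H.l + H.p))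

lemma offDiagNonpos_restMatrix (X : Family) (q : ℕ) (G H : ResidueGroup) :
    OffDiagNonpos (restMatrix X q G H) :=
  ((offDiagNonpos_BD X q).sum ((offDiagNonpos_A _).copies _)).sum ((offDiagNonpos_A _).copies _)

lemma exists_restVec_mem_classSpan (X : Family) (ε : ℕ → V) {n m q : ℕ} {G H : ResidueGroup}
    (hGH : ResidueCover n m G H) (hm : 1 ≤ m) (hq : 1 ≤ q) (hn : q * m ≤ n) (x) :
    ∃ r, 2 * r < m ∧ restVec X ε m q G H x ∈ classSpan ε n m r := by
  rcases x with (x | x) | x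
  · exact ⟨0, by omega, chainVec_mem_classSpan X ε hq (by simpa using hn) x⟩
  · have h := hGH.chain_left x.2 x.2.2
    exact ⟨_, h.two_mul_lt, stepVec_mem_classSpan ε h x.1⟩
  · have h := hGH.chain_right x.2 x.2.2
    exact ⟨_, h.two_mul_lt, stepVec_mem_classSpan ε h x.1⟩

omit [Module ℝ V] in
lemma exists_restVec_eq (X : Family) (ε : ℕ → V) {n m q : ℕ} {G H : ResidueGroup}
    (hGH : ResidueCover n m G H) {a : ℤ} {r : ℕ} (hr : 0 < r) (hrm : 2 * r < m)
    (hd : (m : ℤ) ∣ a - r) (h1 : -(n : ℤ) ≤ a) (h2 : a + m ≤ n) :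
    ∃ x, restVec X ε m q G H x = signed ε (a + m) - signed ε a := by
  rcases hGH.cover r hr hrm with ⟨s, hs, rfl⟩ | ⟨s, hs, rfl⟩
  · obtain ⟨x, hx⟩ := Realization.exists_stepVec_eq (ε := ε) (hGH.chain_left s hs) hd h1 h2
    exact ⟨.inl (.inr (x, ⟨s, hs⟩)), hx⟩
  · obtain ⟨x, hx⟩ := Realization.exists_stepVec_eq (ε := ε) (hGH.chain_right s hs) hd h1 h2
    exact ⟨.inr (x, ⟨s, hs⟩), hx⟩

variable [P.IsRootSystem] {X : Family} {n : ℕ} {e : Fin (X.rank n) ≃ b.support}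
  {ε : ℕ → V} {g : V →ₗ[ℝ] V →ₗ[ℝ] ℝ} {m q : ℕ} {G H : ResidueGroup}

namespace Realization

variable (hR : Realization X n e ε g)

include hR

lemma represents_groupVec (hG : ∀ s < G.c, ResidueChain n m (G.r + s) G.l G.p) :
    Represents g (groupVec ε m G) (copies G.c (typeA (G.l + G.p))) := by
  refine represents_copies (v := fun (s : Fin G.c) x =>
    stepVec (resVec ε m (G.r + s) G.l) (G.l + G.p) x)
    (fun s => hR.represents_stepVec_resVec (hG s s.2)) fun s s' x y hs => ?_
  have h := hG s s.2
  have h' := hG s' s'.2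
  exact hR.form_eq_zero_of_mem_classSpan h.two_mul_lt.le h'.two_mul_lt.le
    (fun h0 => hs (Fin.ext (by omega))) (stepVec_mem_classSpan ε h x)
    (stepVec_mem_classSpan ε h' y)

lemma represents_restVec (hGH : ResidueCover n m G H) (hm : 1 ≤ m) (hq : 1 ≤ q)
    (hn : q * m ≤ n) : Represents g (restVec X ε m q G H) (restMatrix X q G H) := by
  have h0 : ∀ x, chainVec X (fun c => ε (0 + c * m)) q x ∈ classSpan ε n m 0 :=
    chainVec_mem_classSpan X ε hq (by simpa using hn)
  have key : ∀ {K : ResidueGroup}, (∀ s < K.c, ResidueChain n m (K.r + s) K.l K.p) → ∀ x y,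
      g (chainVec X (fun c => ε (0 + c * m)) q x) (groupVec ε m K y) = 0 := by
    intro K hK x y
    have h := hK y.2 y.2.2
    have := h.pos
    exact hR.form_eq_zero_of_mem_classSpan (by omega) h.two_mul_lt.le (by omega) (h0 x)
      (stepVec_mem_classSpan ε h y.1)
  have key2 : ∀ x y, g (groupVec ε m G x) (groupVec ε m H y) = 0 := fun x y => by
    have h := hGH.chain_left x.2 x.2.2
    have h' := hGH.chain_right y.2 y.2.2
    exact hR.form_eq_zero_of_mem_classSpan h.two_mul_lt.le h'.two_mul_lt.le
      (hGH.disj _ x.2.2 _ y.2.2) (stepVec_mem_classSpan ε h x.1) (stepVec_mem_classSpan ε h' y.1)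
  have key3 : ∀ x y, g (Sum.elim (chainVec X (fun c => ε (0 + c * m)) q) (groupVec ε m G) x)
      (groupVec ε m H y) = 0 := by
    rintro (x | x) y
    · exact key hGH.chain_right x y
    · exact key2 x y
  refine Represents.sum (Represents.sum (hR.represents_chainVec_zero hm hq hn)
    (hR.represents_groupVec hGH.chain_left) (key hGH.chain_left) fun y x => ?_)
    (hR.represents_groupVec hGH.chain_right) key3 fun y x => ?_
  · rw [hR.form_symm]; exact key hGH.chain_left _ _
  · rw [hR.form_symm]; exact key3 _ _

lemma exists_root_restVec (hGH : ResidueCover n m G H) (hm : 1 ≤ m) (hq : 1 ≤ q)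
    (hn : q * m ≤ n) (x) : ∃ i, b.height i = m ∧ P.root i = restVec X ε m q G H x := by
  rcases x with (x | x) | x
  · exact hR.exists_root_chainVec_zero hm hq hn x
  · exact hR.exists_root_stepVec (hGH.chain_left x.2 x.2.2) x.1
  · exact hR.exists_root_stepVec (hGH.chain_right x.2 x.2.2) x.1

/-- A root of height m joins two neighbours x, x + m of one residue class, or their negatives.
Normalising the residue to at most m/2 leaves class 0, the classes covered by `G` and `H`, and, for
even m, the class of m/2. -/
lemma height_eq_cases {t : ℕ} (hGH : ResidueCover n m G H) (hm : 1 ≤ m)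
    (hnq : n = q * m + t) (ht : t < m) {i : ι} (hi : b.height i = m) :
    (∃ x, P.root i = restVec X ε m q G H x) ∨ ∃ k c, m = 2 * k ∧ 1 ≤ c ∧ k + c * m ≤ n ∧
      P.root i = ε (k + c * m) - ε (k + (c - 1) * m) := by
  have hpos : b.IsPos i := by rw [Base.isPos_iff, hi]; omega
  obtain ⟨a, c, hac, hc, h | h⟩ := hR.pos_cases i hpos
  · have hht := hR.height_of_root_eq_sub (a := c) (c := a) (by simpa using hc) (by simp; omega)
      (by simpa using h)
    obtain rfl : c = a + m := by omega
    have hdm := Nat.div_add_mod a m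
    have hlt := Nat.mod_lt a (show m > 0 by omega)
    set r := a % m
    have hd : (m : ℤ) ∣ a - r := ⟨(a / m : ℕ), by
      have h1 : ((m * (a / m) + r : ℕ) : ℤ) = a := by rw [hdm]
      rw [Nat.cast_add, Nat.cast_mul] at h1
      linarith⟩
    rcases Nat.eq_zero_or_pos r with h0 | h0
    · obtain ⟨x, hx⟩ := hR.exists_chainVec_zero_eq hnq ht (Nat.dvd_of_mod_eq_zero h0) hc
        (Or.inl h)
      exact Or.inl ⟨.inl (.inl x), hx⟩
    rcases lt_trichotomy (2 * r) m with h2 | h2 | h2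
    · obtain ⟨x, hx⟩ := exists_restVec_eq (q := q) X ε hGH (a := a) h0 h2 hd (by omega) (by omega)
      exact Or.inl ⟨x, by rw [hx, h, ← Nat.cast_add, signed_natCast, signed_natCast]⟩
    · refine Or.inr ⟨r, a / m + 1, h2.symm, Nat.le_add_left _ _, ?_, ?_⟩
      · rw [add_mul, mul_comm (a / m)]; omega
      · rw [h, Nat.add_sub_cancel, add_mul, mul_comm (a / m)]
        congr 2 <;> omega
    -- For r > m/2, read the root as ε_{-a} - ε_{-(a+m)}, in the class of m - r < m/2.
    · have h3 : (m : ℤ) ∣ -((a + m : ℕ) : ℤ) - (m - r : ℕ) := by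
        have h3 := (dvd_neg.2 hd).sub (dvd_mul_right (m : ℤ) 2)
        rwa [Nat.cast_sub hlt.le, Nat.cast_add,
          show -((a : ℤ) + m) - (m - r) = -(a - r) - m * 2 by ring]
      obtain ⟨x, hx⟩ := exists_restVec_eq (q := q) X ε hGH (by omega) (by omega) h3 (by omega)
        (by omega)
      refine Or.inl ⟨x, ?_⟩
      rw [hx, h, show -((a + m : ℕ) : ℤ) + m = -a by push_cast; ring, signed_neg ε (by omega),
        signed_neg ε (by omega), signed_natCast, signed_natCast]
      abel
  · have hht := hR.height_of_root_eq_add hc (by omega) h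
    rcases Nat.eq_zero_or_pos a with rfl | ha
    · obtain rfl : c = m := by omega
      obtain ⟨x, hx⟩ := hR.exists_chainVec_zero_eq hnq ht (dvd_zero c) (by omega)
        (Or.inr ⟨rfl, by simpa using h⟩)
      exact Or.inl ⟨.inl (.inl x), hx⟩
    -- With a + c = m, the root is ε_a - ε_{-c}, in the class of a; here 2a < m because a < c.
    · obtain ⟨x, hx⟩ := exists_restVec_eq (q := q) X ε hGH (a := -(c : ℤ))
        (r := a) ha (by omega) ⟨-1, by omega⟩ (by omega) (by omega)
      refine Or.inl ⟨x, ?_⟩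
      rw [hx, h, show -(c : ℤ) + m = a by omega, signed_neg ε (by omega),
        signed_natCast, signed_natCast]
      abel

end Realization

end Diagrams

/-! ### Counting the members of each residue class in [-n, n] -/

section Cover

variable {n m q t k : ℕ}

/-- Upwards from r there are q steps if r ≤ t and q - 1 otherwise; downwards there are q if r + t <
m and q + 1 otherwise. This and the next two lemmas are the cases that occur, with 2q, 2q - 1 and 2q
+ 1 steps in all. -/
lemma residueChain_low {r : ℕ} (hnq : n = q * m + t) (hr : 0 < r) (hrm : 2 * r < m)
    (hrt : r ≤ t) (h : t + r < m) : ResidueChain n m r q q where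
  pos := hr
  two_mul_lt := hrm
  lower := by omega
  lower' := by rw [add_mul]; omega
  upper := by omega
  upper' := by rw [add_mul]; omega

lemma residueChain_mid {r : ℕ} (hnq : n = q * m + t) (hq : 1 ≤ q) (hr : 0 < r) (hrm : 2 * r < m)
    (hrt : t < r) : ResidueChain n m r q (q - 1) := by
  obtain ⟨q, rfl⟩ := Nat.exists_eq_add_of_le' hq
  rw [Nat.add_sub_cancel]
  refine ⟨hr, hrm, ?_, ?_, ?_, ?_⟩ <;> (try simp only [add_mul, one_mul] at *) <;> omega

lemma residueChain_high {r : ℕ} (hnq : n = q * m + t) (ht : t < m) (hr : 0 < r)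
    (hrm : 2 * r < m) (h : m ≤ t + r) : ResidueChain n m r (q + 1) q := by
  refine ⟨hr, hrm, ?_, ?_, ?_, ?_⟩ <;> (try simp only [add_mul, one_mul] at *) <;> omega

/-- The number `d` counts the classes strictly between 0 and m/2: it is k for m = 2k + 1 and k - 1
for m = 2k. The classes 1, …, t have 2q steps, the classes t + 1, …, d have 2q - 1. -/
lemma residueCover_low {d : ℕ} (hnq : n = q * m + t) (hq : 1 ≤ q) (ht : 2 * t < m)
    (hd : ∀ r, 2 * r < m ↔ r ≤ d) :
    ResidueCover n m ⟨1, q, q, t⟩ ⟨t + 1, q, q - 1, d - t⟩ := by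
  have := (hd t).1 ht
  refine ⟨fun s hs => ?_, fun s hs => ?_, fun s hs s' hs' => ?_, fun r hr hrm => ?_⟩
  · simp only at *
    exact residueChain_low hnq (by omega) (by omega) (by omega) (by omega)
  · simp only at *
    exact residueChain_mid hnq hq (by omega) ((hd _).2 (by omega)) (by omega)
  · simp only at *
    omega
  · have := (hd r).1 hrm
    simp only
    rcases le_or_gt r t with h | h
    · exact Or.inl ⟨r - 1, by omega, by omega⟩
    · exact Or.inr ⟨r - (t + 1), by omega, by omega⟩

/-- The classes below m - t have 2q steps, the classes m - t, …, d have 2q + 1. -/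
lemma residueCover_high {d : ℕ} (hnq : n = q * m + t) (ht : t < m) (htm : m ≤ 2 * t)
    (hd : ∀ r, 2 * r < m ↔ r ≤ d) :
    ResidueCover n m ⟨1, q, q, m - 1 - t⟩ ⟨m - t, q + 1, q, d + t + 1 - m⟩ := by
  have h0 := (hd (m - t - 1)).1 (by omega)
  refine ⟨fun s hs => ?_, fun s hs => ?_, fun s hs s' hs' => ?_, fun r hr hrm => ?_⟩
  · simp only at *
    exact residueChain_low hnq (by omega) ((hd _).2 (by omega)) (by omega) (by omega)
  · simp only at *
    exact residueChain_high hnq ht (by omega) ((hd _).2 (by omega)) (by omega)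
  · simp only at *
    omega
  · have := (hd r).1 hrm
    simp only
    rcases lt_or_ge r (m - t) with h | h
    · exact Or.inl ⟨r - 1, by omega, by omega⟩
    · exact Or.inr ⟨r - (m - t), by omega, by omega⟩

lemma ResidueCover.symm {G H : ResidueGroup} (h : ResidueCover n m G H) :
    ResidueCover n m H G where
  chain_left := h.chain_right
  chain_right := h.chain_left
  disj s hs s' hs' := (h.disj s' hs' s hs).symm
  cover r hr hrm := (h.cover r hr hrm).symm

end Cover

end HeightSubsystem

namespace HeightSubsystem

open RootPairing

/-! ### Levi type, and the type of R(m) in the Levi case -/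

section Levi

variable {ι V N : Type*} [AddCommGroup V] [Module ℝ V] [AddCommGroup N] [Module ℝ N]
  {P : RootPairing ι ℝ V N} {b : P.Base} [P.IsRootSystem] {X : Family} {n : ℕ}
  {e : Fin (X.rank n) ≃ b.support} {ε : ℕ → V} {g : V →ₗ[ℝ] V →ₗ[ℝ] ℝ} {m q : ℕ}
  {G H : ResidueGroup}

lemma bmod_sub_bmod_eq_zero_iff (hm : 1 ≤ m) (a c : ℤ) :
    c.bmod m - a.bmod m = 0 ↔ (m : ℤ) ∣ c - a := by
  have h1 := Int.dvd_bmod_sub_self (x := c) (m := m)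
  have h2 := Int.dvd_bmod_sub_self (x := a) (m := m)
  have h3 := h1.sub h2
  constructor
  · intro h
    rw [show c - a = -(c.bmod m - c - (a.bmod m - a)) by linarith]
    exact dvd_neg.2 h3
  · intro h
    have h4 := h3.add h
    rw [show c.bmod m - c - (a.bmod m - a) + (c - a) = c.bmod m - a.bmod m by ring] at h4
    refine Int.eq_zero_of_abs_lt_dvd h4 ?_
    have h5 := Int.le_bmod (x := c) (m := m) (by omega)
    have h6 := Int.le_bmod (x := a) (m := m) (by omega)
    have h7 := Int.bmod_lt (x := c) (m := m) (by omega)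
    have h8 := Int.bmod_lt (x := a) (m := m) (by omega)
    rw [abs_lt]
    omega

/-- A sum of two balanced residues lies in [-m, m), so if divisible by m it is 0 or -m. The value -m
requires m = 2k and a, c both congruent to k, hence a ≥ k and c ≥ 3k, which `h` excludes. -/
lemma bmod_add_bmod_eq_zero_iff (hm : 1 ≤ m) {a c : ℕ} (hac : a < c) (hc : c ≤ n)
    (h : ∀ k, m = 2 * k → n < 3 * k) :
    (c : ℤ).bmod m + (a : ℤ).bmod m = 0 ↔ (m : ℤ) ∣ c + a := by
  have h1 := Int.dvd_bmod_sub_self (x := c) (m := m)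
  have h2 := Int.dvd_bmod_sub_self (x := a) (m := m)
  have h3 := h1.add h2
  constructor
  · intro h
    rw [show (c : ℤ) + a = -((c : ℤ).bmod m - c + ((a : ℤ).bmod m - a)) by linarith]
    exact dvd_neg.2 h3
  · intro h'
    have h4 := h3.add h'
    rw [show (c : ℤ).bmod m - c + ((a : ℤ).bmod m - a) + (c + a) =
      (c : ℤ).bmod m + (a : ℤ).bmod m by ring] at h4
    have h5 := Int.le_bmod (x := c) (m := m) (by omega)
    have h6 := Int.le_bmod (x := a) (m := m) (by omega)
    have h7 := Int.bmod_lt (x := c) (m := m) (by omega)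
    have h8 := Int.bmod_lt (x := a) (m := m) (by omega)
    by_cases h9 : (c : ℤ).bmod m = -(m / 2) ∧ (a : ℤ).bmod m = -(m / 2) ∧ (2 : ℤ) * (m / 2) = m
    · exfalso
      have h10 := h (m / 2) (by omega)
      have h11 := h1.sub h2
      rw [h9.1, h9.2.1] at h11
      have h12 := Int.le_of_dvd (by omega) ((dvd_neg (α := ℤ)).2 h11)
      rw [h9.2.1] at h2
      have h13 := Int.le_of_dvd (by omega) ((dvd_neg (α := ℤ)).2 h2)
      omega
    · refine Int.eq_zero_of_abs_lt_dvd h4 ?_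
      rw [abs_lt]
      omega

namespace Realization

variable (hR : Realization X n e ε g)

include hR

/-- The condition `hw` is forced in type B, where ε_0 = 0. -/
lemma exists_functional (w : ℕ → ℝ) (hw : w 0 = 0) :
    ∃ φ : V →ₗ[ℝ] ℝ, ∀ c ≤ n, φ (ε c) = w c := by
  refine ⟨∑ a ∈ Finset.range (n + 1), w a • g (ε a), fun c hc => ?_⟩
  rw [LinearMap.sum_apply, Finset.sum_eq_single c]
  · rw [LinearMap.smul_apply, hR.form_eps c c hc hc, if_pos rfl]
    split_ifs with h
    · rw [h, hw]; simp
    · simp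
  · intro a ha hac
    rw [LinearMap.smul_apply, hR.form_eps a c (by simpa [Nat.lt_succ_iff] using ha) hc, if_neg hac,
      smul_zero]
  · intro h
    exact absurd (Finset.mem_range.2 (by omega)) h

lemma exists_coweight (w : ℕ → ℝ) (hw : w 0 = 0) :
    ∃ φ : N, ∀ c ≤ n, P.toLinearMap (ε c) φ = w c := by
  obtain ⟨φ, hφ⟩ := hR.exists_functional w hw
  obtain ⟨x, hx⟩ := (LinearMap.IsPerfPair.bijective_right P.toLinearMap).2 φ
  exact ⟨x, fun c hc => by rw [← hφ c hc, ← hx]; rfl⟩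

lemma isLeviType_rootsMult [Finite ι] [P.IsCrystallographic] [P.IsReduced] (hm : 1 ≤ m)
    (h : ∀ k, m = 2 * k → n < 3 * k) : IsLeviType b (rootsMult b m) := by
  obtain ⟨φ, hφ⟩ := hR.exists_coweight (fun a => ((a : ℤ).bmod m : ℝ)) (by simp)
  have key : ∀ i, b.IsPos i → (i ∈ rootsMult b m ↔ P.root' i φ = 0) := by
    intro i hi
    obtain ⟨a, c, hac, hc, h1 | h1⟩ := hR.pos_cases i hi
    · have hht := hR.height_of_root_eq_sub (a := c) (c := a) (by simpa using hc) (by simp; omega)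
        (by simpa using h1)
      change (m : ℤ) ∣ b.height i ↔ P.toLinearMap (P.root i) φ = 0
      rw [h1, map_sub, LinearMap.sub_apply, hφ c hc, hφ a (by omega), hht,
        ← bmod_sub_bmod_eq_zero_iff hm]
      norm_cast
    · have hht := hR.height_of_root_eq_add hc (by omega) h1
      change (m : ℤ) ∣ b.height i ↔ P.toLinearMap (P.root i) φ = 0
      rw [h1, map_add, LinearMap.add_apply, hφ c hc, hφ a (by omega), hht,
        ← bmod_add_bmod_eq_zero_iff hm hac hc h]
      norm_cast
  have : rootsMult b m = {i | P.root' i φ = 0} := by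
    ext i
    rcases Base.IsPos.or_neg b i with hi | hi
    · exact key i hi
    · have h1 : P.reflectionPerm i i ∈ rootsMult b m ↔ P.root' (P.reflectionPerm i i) φ = 0 :=
        key _ hi
      have h2 : P.root' (P.reflectionPerm i i) φ = -P.root' i φ := by
        change P.toLinearMap (P.root (P.reflectionPerm i i)) φ = _
        rw [root_neg]
        simp
      rw [h2, neg_eq_zero] at h1
      rw [Set.mem_ofPred_eq, ← h1]
      refine ⟨fun h => ?_, fun h => ?_⟩
      · exact neg_mem_rootsMult b m h
      · simpa [rootsMult, height_neg] using h
  rw [this]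
  exact isLeviType_orthogonal b φ

/-- The roots ε_{2k} ± ε_0 and ε_{3k} ± ε_k lie in R(2k), so ε_{2k} and ε_k lie in its span. Their
sum is a root of height 3k, which is not a multiple of 2k. -/
lemma not_isLeviType_rootsMult [Finite ι] [P.IsCrystallographic] [P.IsReduced] {k : ℕ}
    (hk : 1 ≤ k) (hkn : 3 * k ≤ n) : ¬ IsLeviType b (rootsMult b (2 * k)) := by
  intro hL
  have key : ∀ a c : ℕ, a < c → c ≤ n → 2 * k ∣ c - a → 2 * k ∣ c + a →
      ε c ∈ Submodule.span ℝ (P.root '' rootsMult b (2 * k)) ∧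
      ε a ∈ Submodule.span ℝ (P.root '' rootsMult b (2 * k)) := by
    intro a c hac hc h1 h2
    obtain ⟨i, hi⟩ := hR.exists_sub a c hac hc
    obtain ⟨j, hj⟩ := hR.exists_add a c hac hc
    have hi' := hR.height_of_root_eq_sub (a := c) (c := a) (by simpa using hc) (by simp; omega)
        (by simpa using hi)
    have hj' := hR.height_of_root_eq_add hc (by omega) hj
    have hi2 : P.root i ∈ Submodule.span ℝ (P.root '' rootsMult b (2 * k)) :=
      Submodule.subset_span ⟨i, by
        change ((2 * k : ℕ) : ℤ) ∣ _
        rw [hi', ← Nat.cast_sub hac.le]; exact_mod_cast h1, rfl⟩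
    have hj2 : P.root j ∈ Submodule.span ℝ (P.root '' rootsMult b (2 * k)) :=
      Submodule.subset_span ⟨j, by
        change ((2 * k : ℕ) : ℤ) ∣ _
        rw [hj']; exact_mod_cast h2, rfl⟩
    rw [hi] at hi2
    rw [hj] at hj2
    constructor
    · convert Submodule.smul_mem _ (1 / 2 : ℝ) (add_mem hi2 hj2) using 1
      module
    · convert Submodule.smul_mem _ (1 / 2 : ℝ) (sub_mem hj2 hi2) using 1
      module
  obtain ⟨i, hi⟩ := hR.exists_add k (2 * k) (by omega) (by omega)
  have h1 := (key 0 (2 * k) (by omega) (by omega) (by simp) (by simp)).1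
  have h2 := (key k (3 * k) (by omega) hkn ⟨1, by omega⟩ ⟨2, by omega⟩).2
  have h3 : i ∈ rootsMult b (2 * k) := hL.mem_of_mem_span (hi ▸ add_mem h1 h2)
  have h4 : ((2 * k : ℕ) : ℤ) ∣ b.height i := h3
  rw [hR.height_of_root_eq_add (by omega) (by omega) hi] at h4
  norm_cast at h4
  have h5 := (Nat.dvd_add_right dvd_rfl).1 h4
  have := Nat.le_of_dvd (by omega) h5
  omega

lemma hasType_rootsMult [Finite ι] [P.IsCrystallographic] [P.IsReduced] {t : ℕ}
    (hGH : ResidueCover n m G H) (hm : 1 ≤ m) (hq : 1 ≤ q)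
    (hnq : n = q * m + t) (ht : t < m) (h : ∀ k, m = 2 * k → n < 3 * k) :
    HasType P (rootsMult b m) (restMatrix X q G H) := by
  refine ⟨_, isBaseOf_simpleRootsMult b m, hR.hasDiagram_of_represents
    (hR.represents_restVec hGH hm hq (by omega)) (offDiagNonpos_restMatrix X q G H) ?_⟩
  ext v
  constructor
  · rintro ⟨i, hi, rfl⟩
    rcases hR.simpleRootsMult_cases hm hi with hi | ⟨k, hk, hkn, -⟩
    · rcases hR.height_eq_cases hGH hm hnq ht hi with ⟨x, hx⟩ | ⟨k, c, hk, hc, hkn, -⟩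
      · exact ⟨x, hx.symm⟩
      · have := h k hk
        nlinarith
    · have := h k hk
      omega
  · rintro ⟨x, rfl⟩
    obtain ⟨i, hi, hi'⟩ := hR.exists_root_restVec hGH hm hq (by omega) x
    exact ⟨i, mem_simpleRootsMult_of_height hm hi, hi'⟩

end Realization

end Levi

end HeightSubsystem

/-! ### The class of k = m/2, the component of δ, and the rows of the table -/

namespace HeightSubsystem

open RootPairing

/-- For `m = 2 * k`, the elements of `[0, n]` congruent to `k` modulo `m` are the integers
`k + c * m` with `c ≤ p`. -/
structure HalfClass (n m k p : ℕ) : Prop where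
  eq_two_mul : m = 2 * k
  pos : 1 ≤ k
  one_le : 1 ≤ p
  upper : k + p * m ≤ n
  upper' : n < k + (p + 1) * m

namespace HalfClass

variable {n m k p : ℕ} (h : HalfClass n m k p)

include h

lemma le_of_le {c : ℕ} (hc : c ≤ p) : k + c * m ≤ n := le_trans (by gcongr) h.upper

lemma le_of_le_p {c : ℕ} (hc : k + c * m ≤ n) : c ≤ p := by
  by_contra h1
  have : (p + 1) * m ≤ c * m := Nat.mul_le_mul_right m (by omega)
  have := h.upper'
  omega

lemma three_mul_le : 3 * k ≤ n := by
  have := h.le_of_le h.one_le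
  have := h.eq_two_mul
  omega

lemma one_le_m : 1 ≤ m := by
  have := h.eq_two_mul
  have := h.pos
  omega

end HalfClass

section Table

variable {ι V N : Type*} [AddCommGroup V] [Module ℝ V] [AddCommGroup N] [Module ℝ N]
  {P : RootPairing ι ℝ V N} {b : P.Base}

/-- The unit vectors `ε_a` with `a` congruent to `k` modulo `m`. -/
abbrev halfVec (ε : ℕ → V) (m k : ℕ) (c : ℕ) : V := ε (k + c * m)

variable [P.IsRootSystem] {X : Family} {n : ℕ} {e : Fin (X.rank n) ≃ b.support}
  {ε : ℕ → V} {g : V →ₗ[ℝ] V →ₗ[ℝ] ℝ} {m k p q t : ℕ} {G H : ResidueGroup}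

namespace Realization

variable (hR : Realization X n e ε g)

include hR

lemma sum_simpleRoot {a c : ℕ} (hac : a ≤ c) (hc : c ≤ n) :
    ∑ j ∈ Finset.Icc (a + 1) c, simpleRoot X n e j = ε c - ε a := by
  induction c, hac using Nat.le_induction with
  | base => simp
  | succ c hac ih =>
    rw [Finset.sum_Icc_succ_top (by omega), ih (by omega), hR.simple_succ _ (by omega) hc,
      Nat.add_sub_cancel]
    abel

/-- The part of the sum up to index k is 2ε_k in both types (in type D because α_0 + α_1 = 2ε_1);
the rest is ε_{3k} - ε_k. -/
lemma deltaRoot_eq (hk : 1 ≤ k) (hkn : 3 * k ≤ n) : deltaRoot X n e k = ε (3 * k) + ε k := by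
  have h1 := hR.sum_simpleRoot (a := k) (c := 3 * k) (by omega) hkn
  cases X with
  | B =>
    have h2 := hR.sum_simpleRoot (a := 0) (c := k) (by omega) (by omega)
    rw [zero_add, hR.eps_zero rfl] at h2
    simp only [deltaRoot]
    rw [h1, h2]
    module
  | D =>
    have h2 := hR.sum_simpleRoot (a := 1) (c := k) hk (by omega)
    simp only [deltaRoot]
    rw [h1, h2, hR.simple_zero rfl, hR.simple_succ 1 le_rfl (by omega)]
    module

lemma mem_chainRoots_iff (h : HalfClass n m k p) {i : ι} : i ∈ chainRoots X n e m k p ↔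
    ∃ c, 1 ≤ c ∧ c ≤ p ∧ P.root i = halfVec ε m k c - halfVec ε m k (c - 1) := by
  refine exists_congr fun c => and_congr_right fun h1 => and_congr_right fun h2 => ?_
  rw [hR.sum_simpleRoot (by gcongr; omega) (h.le_of_le h2)]

lemma form_halfVec (h : HalfClass n m k p) {a c : ℕ} (ha : a ≤ p) (hc : c ≤ p) :
    g (halfVec ε m k a) (halfVec ε m k c) = if a = c then 1 else 0 := by
  have := h.pos
  have := h.one_le_m
  rw [hR.form_eps _ _ (h.le_of_le ha) (h.le_of_le hc)]
  simp [show m ≠ 0 by omega, show k ≠ 0 by omega]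

lemma exists_chainRoot (h : HalfClass n m k p) {c : ℕ} (h1 : 1 ≤ c) (h2 : c ≤ p) :
    ∃ i, b.height i = m ∧ P.root i = halfVec ε m k c - halfVec ε m k (c - 1) := by
  have := hR.exists_root_sub_height (m := m) (r := k) (c := c - 1) h.one_le_m
    (by rw [Nat.sub_add_cancel h1]; exact h.le_of_le h2)
  rwa [Nat.sub_add_cancel h1] at this

lemma height_of_mem_chainRoots (h : HalfClass n m k p) {i : ι}
    (hi : i ∈ chainRoots X n e m k p) : b.height i = m := by
  obtain ⟨c, h1, h2, hc⟩ := (hR.mem_chainRoots_iff h).1 hi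
  obtain ⟨j, hj, hj'⟩ := hR.exists_chainRoot h h1 h2
  rwa [P.root.injective (hc.trans hj'.symm)]

lemma exists_delta (h : HalfClass n m k p) : ∃ δ, P.root δ = deltaRoot X n e k ∧
    P.root δ = halfVec ε m k 1 + halfVec ε m k 0 ∧ b.height δ = 2 * m ∧
    simpleRootsMult b m = rootsHeight b m ∪ {δ} := by
  obtain ⟨hmk, hk, -, -, -⟩ := id h
  have hkn := h.three_mul_le
  obtain ⟨δ, hδ⟩ := hR.exists_add k (3 * k) (by omega) hkn
  refine ⟨δ, by rw [hδ, hR.deltaRoot_eq hk hkn], ?_, ?_, ?_⟩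
  · rw [hδ, halfVec, halfVec, zero_mul, one_mul, show k + m = 3 * k by omega, add_zero]
  · rw [hR.height_of_root_eq_add hkn (by omega) hδ, hmk]
    push_cast
    ring
  · ext i
    constructor
    · intro hi
      rcases hR.simpleRootsMult_cases h.one_le_m hi with hi | ⟨k', hk', -, hi⟩
      · exact Or.inl hi
      · obtain rfl : k' = k := by omega
        exact Or.inr (P.root.injective (hi.trans hδ.symm))
    · rintro (hi | rfl)
      · exact mem_simpleRootsMult_of_height h.one_le_m hi
      · rw [hmk]
        exact hR.delta_mem_simpleRootsMult hk hkn hδ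

lemma image_chainRoots (h : HalfClass n m k p) :
    P.root '' chainRoots X n e m k p = Set.range (stepVec (halfVec ε m k) p) := by
  ext v
  constructor
  · rintro ⟨i, hi, rfl⟩
    obtain ⟨c, h1, h2, hc⟩ := (hR.mem_chainRoots_iff h).1 hi
    refine ⟨⟨c - 1, by omega⟩, ?_⟩
    rw [hc, stepVec]
    simp only [Nat.sub_add_cancel h1]
  · rintro ⟨x, rfl⟩
    obtain ⟨i, -, hi⟩ := hR.exists_chainRoot h (c := x + 1) (by omega) (by omega)
    exact ⟨i, (hR.mem_chainRoots_iff h).2 ⟨x + 1, by omega, by omega, hi⟩, hi⟩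

lemma image_dagger (h : HalfClass n m k p) {δ : ι}
    (hδ : P.root δ = halfVec ε m k 1 + halfVec ε m k 0) :
    P.root '' (chainRoots X n e m k p ∪ {δ}) = Set.range (chainVec .D (halfVec ε m k) p) := by
  rw [Set.image_union, hR.image_chainRoots h, Set.image_singleton, hδ]
  ext v
  constructor
  · rintro (⟨x, rfl⟩ | rfl)
    · refine ⟨⟨p - 1 - x, by simp only [Family.rank]; omega⟩, ?_⟩
      rw [chainVec, if_neg (by simp only; omega), stepVec]
      simp only
      rw [show p - (p - 1 - (x : ℕ)) = x + 1 by omega, Nat.add_sub_cancel]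
    · exact ⟨⟨p, by simp only [Family.rank]; omega⟩, by rw [chainVec, if_pos rfl]⟩
  · rintro ⟨x, rfl⟩
    have hx : (x : ℕ) < p + 1 := x.2
    rw [chainVec]
    split_ifs with h1
    · exact Or.inr rfl
    · refine Or.inl ⟨⟨p - 1 - x, by omega⟩, ?_⟩
      rw [stepVec]
      simp only
      rw [show p - 1 - (x : ℕ) + 1 = p - x by omega, show p - 1 - (x : ℕ) = p - x - 1 by omega]

lemma dagger_mem_classSpan (h : HalfClass n m k p) {δ i : ι}
    (hδ : P.root δ = halfVec ε m k 1 + halfVec ε m k 0) (hi : i ∈ chainRoots X n e m k p ∪ {δ}) :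
    P.root i ∈ classSpan ε n m k := by
  have h1 : P.root i ∈ Set.range (chainVec .D (halfVec ε m k) p) :=
    hR.image_dagger h hδ ▸ ⟨i, hi, rfl⟩
  obtain ⟨x, hx⟩ := h1
  exact hx ▸ chainVec_mem_classSpan .D ε h.one_le h.upper x

lemma mem_dagger_or (h : HalfClass n m k p) (hGH : ResidueCover n m G H)
    (hnq : n = q * m + t) (ht : t < m) {δ i : ι}
    (hΓ : simpleRootsMult b m = rootsHeight b m ∪ {δ}) (hi : i ∈ simpleRootsMult b m) :
    i ∈ chainRoots X n e m k p ∪ {δ} ∨ ∃ x, P.root i = restVec X ε m q G H x := by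
  rw [hΓ] at hi
  rcases hi with hi | hi
  · rcases hR.height_eq_cases hGH h.one_le_m hnq ht hi with hx | ⟨k', c, hk', h1, h2, h3⟩
    · exact Or.inr hx
    · have := h.eq_two_mul
      obtain rfl : k' = k := by omega
      exact Or.inl (Or.inl ((hR.mem_chainRoots_iff h).2 ⟨c, h1, h.le_of_le_p h2, h3⟩))
  · exact Or.inl (Or.inr hi)

lemma form_restVec_dagger (h : HalfClass n m k p) (hGH : ResidueCover n m G H) (hq : 1 ≤ q)
    (hn : q * m ≤ n) (x) {v : V} (hv : v ∈ classSpan ε n m k) :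
    g (restVec X ε m q G H x) v = 0 := by
  obtain ⟨r, hr, hx⟩ := exists_restVec_mem_classSpan X ε hGH h.one_le_m hq hn x
  have := h.eq_two_mul
  exact hR.form_eq_zero_of_mem_classSpan hr.le (by omega) (by omega) hx hv

lemma image_simpleRootsMult_diff (h : HalfClass n m k p) (hGH : ResidueCover n m G H) (hq : 1 ≤ q)
    (hnq : n = q * m + t) (ht : t < m) {δ : ι}
    (hδ : P.root δ = halfVec ε m k 1 + halfVec ε m k 0)
    (hΓ : simpleRootsMult b m = rootsHeight b m ∪ {δ}) :
    P.root '' (simpleRootsMult b m \ (chainRoots X n e m k p ∪ {δ})) =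
      Set.range (restVec X ε m q G H) := by
  ext v
  constructor
  · rintro ⟨i, hi, rfl⟩
    rcases hR.mem_dagger_or h hGH hnq ht hΓ hi.1 with h1 | ⟨x, hx⟩
    · exact absurd h1 hi.2
    · exact ⟨x, hx.symm⟩
  · rintro ⟨x, rfl⟩
    obtain ⟨i, hi, hi'⟩ := hR.exists_root_restVec hGH h.one_le_m hq (by omega) x
    refine ⟨i, ⟨mem_simpleRootsMult_of_height h.one_le_m hi, fun h1 => ?_⟩, hi'⟩
    -- A root in both parts would be orthogonal to itself.
    have h2 := hR.form_restVec_dagger h hGH hq (by omega) x (hR.dagger_mem_classSpan h hδ h1)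
    rw [← hi'] at h2
    exact (hR.form_root_pos i).ne' h2

lemma pairing_eq_zero_iff (i j : ι) : P.pairing i j = 0 ↔ g (P.root i) (P.root j) = 0 := by
  have h1 := hR.pairing_mul i j
  have h2 := hR.form_root_pos j
  constructor
  · intro h
    rw [h] at h1
    linarith
  · intro h
    rw [h, mul_zero] at h1
    exact (mul_eq_zero.1 h1).resolve_right h2.ne'

lemma isOrthogonal_iff (i j : ι) : P.IsOrthogonal i j ↔ g (P.root i) (P.root j) = 0 := by
  rw [IsOrthogonal, hR.pairing_eq_zero_iff, hR.pairing_eq_zero_iff, hR.form_symm (P.root j)]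
  exact and_self_iff

/-- The root δ is orthogonal to the chain root with c = 1, being the other prong of the fork. Paths
start from δ to c = 2, go on to c = 3, …, p, and reach c = 1 from c = 2; this is where p ≥ 2 enters.
-/
lemma dagger_subset_component (h : HalfClass n m k p) (hp : 2 ≤ p) {δ : ι}
    (hδ : P.root δ = halfVec ε m k 1 + halfVec ε m k 0)
    (hΓ : simpleRootsMult b m = rootsHeight b m ∪ {δ}) :
    chainRoots X n e m k p ∪ {δ} ⊆ component P (simpleRootsMult b m) δ := by
  have hΓ' : ∀ {i}, b.height i = m → i ∈ simpleRootsMult b m := fun hi => hΓ ▸ Or.inl hi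
  have hu : ∀ {a c : ℕ}, a ≤ p → c ≤ p → _ := fun ha hc => hR.form_halfVec h ha hc
  have key : ∀ c, 2 ≤ c → c ≤ p → ∀ i, P.root i = halfVec ε m k c - halfVec ε m k (c - 1) →
      i ∈ component P (simpleRootsMult b m) δ := by
    intro c hc
    induction c, hc using Nat.le_induction with
    | base =>
      intro _ i hi
      obtain ⟨j, hj, hj'⟩ := hR.exists_chainRoot h (c := 2) (by omega) hp
      obtain rfl : i = j := P.root.injective (hi.trans hj'.symm)
      refine Relation.ReflTransGen.single ⟨hΓ' hj, ?_⟩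
      rw [Ne, hR.pairing_eq_zero_iff, hδ, hi]
      simp only [map_add, map_sub, LinearMap.add_apply]
      rw [hu (by omega) (by omega), hu (by omega) (by omega), hu (by omega) (by omega),
        hu (by omega) (by omega)]
      norm_num
    | succ c hc ih =>
      intro hcp i hi
      obtain ⟨j, hj, hj'⟩ := hR.exists_chainRoot h (c := c) (by omega) (by omega)
      obtain ⟨l, hl, hl'⟩ := hR.exists_chainRoot h (c := c + 1) (by omega) (by omega)
      obtain rfl : i = l := P.root.injective (hi.trans hl'.symm)
      refine (ih (by omega) j hj').tail ⟨hΓ' hl, ?_⟩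
      rw [Ne, hR.pairing_eq_zero_iff, hj', hi, Nat.add_sub_cancel]
      simp only [map_sub, LinearMap.sub_apply]
      rw [hu (by omega) (by omega), hu (by omega) (by omega), hu (by omega) (by omega),
        hu (by omega) (by omega), if_neg (by omega), if_pos rfl, if_neg (by omega),
        if_neg (by omega)]
      norm_num
  rintro i (hi | rfl)
  · obtain ⟨c, h1, h2, hc⟩ := (hR.mem_chainRoots_iff h).1 hi
    rcases Nat.lt_or_ge c 2 with h3 | h3
    · obtain rfl : c = 1 := by omega
      obtain ⟨j, hj, hj'⟩ := hR.exists_chainRoot h (c := 2) (by omega) hp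
      refine (key 2 le_rfl hp j hj').tail ⟨hΓ' (hR.height_of_mem_chainRoots h hi), ?_⟩
      rw [Ne, hR.pairing_eq_zero_iff, hj', hc]
      simp only [map_sub, LinearMap.sub_apply]
      rw [hu (by omega) (by omega), hu (by omega) (by omega), hu (by omega) (by omega),
        hu (by omega) (by omega)]
      norm_num
    · exact key c h3 h2 i hc
  · exact Relation.ReflTransGen.refl

lemma tableRow_of_dimConst [Fintype ι] [P.IsCrystallographic] [P.IsReduced]
    (h : HalfClass n m k p) (hGH : ResidueCover n m G H) (hq : 1 ≤ q)
    (hnq : n = q * m + t) (ht : t < m) (hdim : dimConst b m = 2 ^ p) :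
    TableRow X n e m k p (restMatrix X q G H) := by
  obtain ⟨δ, hδ, hδ', hht, hΓ⟩ := hR.exists_delta h
  have hsub : chainRoots X n e m k p ∪ {δ} ⊆ simpleRootsMult b m := by
    rw [hΓ]
    exact Set.union_subset_union_left _ fun i hi => hR.height_of_mem_chainRoots h hi
  have horth : ∀ i ∈ chainRoots X n e m k p ∪ {δ},
      ∀ j ∈ simpleRootsMult b m \ (chainRoots X n e m k p ∪ {δ}), P.IsOrthogonal i j := by
    intro i hi j hj
    rcases hR.mem_dagger_or h hGH hnq ht hΓ hj.1 with h1 | ⟨x, hx⟩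
    · exact absurd h1 hj.2
    · rw [hR.isOrthogonal_iff, hR.form_symm, hx]
      exact hR.form_restVec_dagger h hGH hq (by omega) x (hR.dagger_mem_classSpan h hδ' hi)
  have hrest := hR.represents_restVec hGH h.one_le_m hq (by omega)
  have hdag := hR.represents_chainVec_half h.one_le_m h.pos h.one_le h.upper
  have hrd : ∀ x y, g (restVec X ε m q G H x) (chainVec .D (halfVec ε m k) p y) = 0 := fun x y =>
    hR.form_restVec_dagger h hGH hq (by omega) x
      (chainVec_mem_classSpan .D ε h.one_le h.upper y)
  have himd := hR.image_dagger h hδ'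
  have himr := hR.image_simpleRootsMult_diff h hGH hq hnq ht hδ' hΓ
  refine ⟨δ, hδ, hht, hΓ, isBaseOf_simpleRootsMult b m, ?_, _, rfl, hsub, horth, fun hp => ?_,
    hR.hasDiagram_of_represents hrest (offDiagNonpos_restMatrix X q G H) himr,
    hR.hasDiagram_of_represents hdag (offDiagNonpos_BD .D p) himd, ?_, hdim⟩
  · refine hR.hasDiagram_of_represents
      (hrest.sum hdag hrd fun x y => by rw [hR.form_symm]; exact hrd _ _)
      ((offDiagNonpos_restMatrix X q G H).sum (offDiagNonpos_BD .D p)) ?_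
    refine Eq.trans ?_ (Set.Sum.elim_range _ (chainVec .D (halfVec ε m k) p)).symm
    rw [← himr, ← himd, ← Set.image_union, Set.sdiff_union_of_subset hsub]
  · refine (hR.dagger_subset_component h hp hδ' hΓ).antisymm fun i hi => ?_
    induction hi with
    | refl => exact Or.inr rfl
    -- An edge leaving X^† would contradict the orthogonality of X^† to the rest of Γ(m).
    | tail _ hj ih =>
      by_contra h1
      exact hj.2 (horth _ ih _ ⟨hj.1, h1⟩).1
  · have h1 : (chainRoots X n e m k p ∪ {δ}) \ {δ} = chainRoots X n e m k p := by
      refine Set.union_sdiff_cancel_right ?_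
      rintro i ⟨hi, rfl⟩
      have := hR.height_of_mem_chainRoots h hi
      have := h.one_le_m
      omega
    rw [h1]
    exact hR.hasDiagram_of_represents (represents_stepVec g _ p fun a c ha hc =>
      hR.form_halfVec h ha hc) (offDiagNonpos_A p) (hR.image_chainRoots h)

end Realization

end Table

end HeightSubsystem

/-! ### The constant d_m -/

namespace HeightSubsystem

open RootPairing

/-- The values on the unit vectors of the functional that is `1` on the simple roots of `R(m)`,
where `m = 2 * k`. -/
noncomputable def halfWeight (m k a : ℕ) : ℝ := (if a % m = k then (a : ℝ) - k else a) / m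

lemma halfWeight_zero {m k : ℕ} (hk : 1 ≤ k) : halfWeight m k 0 = 0 := by
  rw [halfWeight, if_neg (by rw [Nat.zero_mod]; omega)]
  simp

lemma halfWeight_add_mul {m k : ℕ} (hk : 1 ≤ k) (hm : m = 2 * k) (c : ℕ) :
    halfWeight m k (k + c * m) = c := by
  have : (m : ℝ) ≠ 0 := by norm_cast; omega
  rw [halfWeight, if_pos (by rw [Nat.add_mul_mod_self_right]; exact Nat.mod_eq_of_lt (by omega))]
  push_cast
  field_simp
  ring

lemma halfWeight_sub {m k a c : ℕ} (h : (m : ℤ) ∣ c - a) :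
    halfWeight m k c - halfWeight m k a = (c - a) / m := by
  have h1 : c % m = a % m := ((Nat.modEq_iff_dvd (n := m)).2 h).symm
  rw [halfWeight, halfWeight, h1]
  split_ifs <;> ring

/-- As a and c lie in opposite classes and the class of k is its own negative, either both weights
carry the shift by k or neither does. -/
lemma halfWeight_add {m k a c : ℕ} (hk : 1 ≤ k) (hm : m = 2 * k) (h : m ∣ c + a) :
    (a % m = k ∧ c % m = k) ∨ halfWeight m k c + halfWeight m k a = (c + a) / m := by
  have key : ∀ a c : ℕ, m ∣ c + a → a % m = k → c % m = k := by
    intro a c h ha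
    have h1 := Nat.mod_eq_zero_of_dvd h
    rw [Nat.add_mod, ha] at h1
    have h2 := Nat.mod_lt c (show m > 0 by omega)
    by_contra h3
    rcases Nat.lt_or_ge (c % m + k) m with h4 | h4
    · rw [Nat.mod_eq_of_lt h4] at h1
      omega
    · rw [Nat.mod_eq_sub_mod h4, Nat.mod_eq_of_lt (by omega)] at h1
      omega
  by_cases h1 : a % m = k
  · exact Or.inl ⟨h1, key a c h h1⟩
  · right
    have h2 : c % m ≠ k := fun h2 => h1 (key c a (by rwa [add_comm]) h2)
    rw [halfWeight, halfWeight, if_neg h1, if_neg h2]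
    ring

/-- For c ≥ 1 the inner product telescopes to (c + c)/c = 2; for c = 0 it is empty. -/
lemma prod_range_add_div (p : ℕ) :
    ∏ c ∈ Finset.range (p + 1), ∏ d ∈ Finset.range c, (((c : ℝ) + d + 1) / (c + d)) = 2 ^ p := by
  have key : ∀ c : ℕ, 1 ≤ c → ∀ j : ℕ,
      ∏ d ∈ Finset.range j, (((c : ℝ) + d + 1) / (c + d)) = (c + j) / c := by
    intro c hc j
    have hc' : (c : ℝ) ≠ 0 := by norm_cast; omega
    induction j with
    | zero => simp [hc']
    | succ j ih =>
      have : (c : ℝ) + j ≠ 0 := by positivity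
      rw [Finset.prod_range_succ, ih]
      push_cast
      field_simp
      ring
  rw [Finset.prod_range_succ']
  simp only [Finset.range_zero, Finset.prod_empty, mul_one]
  rw [Finset.prod_congr rfl fun c _ => key (c + 1) (by omega) (c + 1), Finset.prod_congr rfl
    fun c _ => show (((c + 1 : ℕ) : ℝ) + (c + 1 : ℕ)) / (c + 1 : ℕ) = 2 by
      push_cast; field_simp; norm_num]
  simp

section DimConst

variable {ι V N : Type*} [Fintype ι] [AddCommGroup V] [Module ℝ V] [AddCommGroup N] [Module ℝ N]
  {P : RootPairing ι ℝ V N} {b : P.Base} [P.IsRootSystem] [P.IsCrystallographic] [P.IsReduced]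

-- Each simple reflection of R(m) permutes the other elements of R⁺(m), so ρ_m takes the value 1 on
-- Γ(m), just as `F` does; and R⁺(m) consists of sums of elements of Γ(m).
omit [P.IsRootSystem] in
lemma root'_halfSumCoroots {m : ℕ} {F : V →ₗ[ℝ] ℝ}
    (hF : ∀ i ∈ simpleRootsMult b m, F (P.root i) = 1) {i : ι} (hi : i ∈ posRootsMult b m) :
    P.root' i (halfSumCoroots (P := P) (posRootsMult b m)) = F (P.root i) := by
  change P.toLinearMap (P.root i) _ = _
  have hv := posRootsMult_mem_closure b m hi
  generalize P.root i = v at hv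
  induction hv using AddSubmonoid.closure_induction with
  | mem v hv =>
    obtain ⟨j, hj, rfl⟩ := hv
    rw [hF j hj]
    refine toLinearMap_halfSumCoroots hj.1 (fun h => ?_)
      fun l hl hlj => reflectionPerm_mem_posRootsMult b m hj hl hlj
    have h1 : 0 < b.height j := hj.1.2
    have h2 : 0 < b.height (P.reflectionPerm j j) := h.2
    rw [height_neg] at h2
    omega
  | zero => simp
  | add v w _ _ hv hw => rw [map_add, map_add, LinearMap.add_apply, hv, hw]

variable {X : Family} {n : ℕ} {e : Fin (X.rank n) ≃ b.support}
  {ε : ℕ → V} {g : V →ₗ[ℝ] V →ₗ[ℝ] ℝ} {m k p : ℕ}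

namespace Realization

variable (hR : Realization X n e ε g)

include hR

/-- The case m = 1 of `root'_halfSumCoroots`: since 1 is odd, Γ(1) contains only roots of height 1,
and the height is the functional that is 1 on them. -/
lemma root'_halfSumCoroots_isPos {i : ι} (hi : b.IsPos i) :
    P.root' i (halfSumCoroots (P := P) {i | b.IsPos i}) = b.height i := by
  have h1 : posRootsMult b 1 = {i | b.IsPos i} := by
    ext i
    simp [posRootsMult, rootsMult]
  have h2 := root'_halfSumCoroots (b := b) (m := 1) (F := heightFun b) (fun j hj => by
    rw [heightFun_root]
    rcases hR.simpleRootsMult_cases le_rfl hj with h | ⟨k, hk, -⟩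
    · rw [h]; simp
    · omega) (h1.symm ▸ hi : i ∈ posRootsMult b 1)
  rw [← heightFun_root, ← h2, h1]

omit [Fintype ι] [P.IsCrystallographic] [P.IsReduced] in
lemma functional_simpleRootsMult (h : HalfClass n m k p) {F : V →ₗ[ℝ] ℝ}
    (hF : ∀ a ≤ n, F (ε a) = halfWeight m k a) {i : ι} (hi : i ∈ simpleRootsMult b m) :
    F (P.root i) = 1 := by
  obtain ⟨hmk, hk, -, -, -⟩ := id h
  have hm : (m : ℝ) ≠ 0 := by norm_cast; omega
  obtain ⟨δ, -, hδ, -, hΓ⟩ := hR.exists_delta h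
  rw [hΓ] at hi
  rcases hi with hi | rfl
  · have hi : b.height i = m := hi
    have hpos : b.IsPos i := by rw [Base.isPos_iff, hi]; omega
    obtain ⟨a, c, hac, hc, h1 | h1⟩ := hR.pos_cases i hpos
    · have hht := hR.height_of_root_eq_sub (a := c) (c := a) (by simpa using hc) (by simp; omega)
        (by simpa using h1)
      rw [h1, map_sub, hF c hc, hF a (by omega), halfWeight_sub ⟨1, by omega⟩]
      have : (c : ℝ) - a = m := by exact_mod_cast hht.symm.trans hi
      rw [this, div_self hm]
    · have hht := hR.height_of_root_eq_add hc (by omega) h1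
      have h3 : c + a = m := by omega
      rw [h1, map_add, hF c hc, hF a (by omega)]
      -- The shifted case cannot occur: it needs a ≥ k, so c + a > 2k = m.
      rcases halfWeight_add hk hmk (Dvd.intro 1 (by omega) : m ∣ c + a) with ⟨h2, -⟩ | h2
      · have := Nat.mod_le a m
        omega
      · rw [h2, ← Nat.cast_add, h3, div_self hm]
  · rw [hδ, map_add, hF _ (h.le_of_le h.one_le), hF _ (h.le_of_le (by omega)),
      halfWeight_add_mul hk hmk, halfWeight_add_mul hk hmk]
    simp

omit [Fintype ι] [P.IsCrystallographic] [P.IsReduced] in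
lemma exists_half_root (h : HalfClass n m k p) {c d : ℕ} (hdc : d < c) (hc : c ≤ p) :
    ∃ i, P.root i = halfVec ε m k c + halfVec ε m k d ∧ i ∈ posRootsMult b m ∧
      b.height i = ((c + d + 1) * m : ℕ) := by
  obtain ⟨hmk, hk, -, -, -⟩ := id h
  have hm := h.one_le_m
  obtain ⟨i, hi⟩ := hR.exists_add (k + d * m) (k + c * m)
    (by have := Nat.mul_lt_mul_of_pos_right hdc hm; omega) (h.le_of_le hc)
  have hht := hR.height_of_root_eq_add (h.le_of_le hc) (h.le_of_le (by omega)) hi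
  have hht' : b.height i = ((c + d + 1) * m : ℕ) := by
    rw [hht, hmk]
    push_cast
    ring
  refine ⟨i, hi, ⟨?_, ?_⟩, hht'⟩
  · change (m : ℤ) ∣ _
    rw [hht']
    exact ⟨(c + d + 1 : ℕ), by push_cast; ring⟩
  · rw [Base.isPos_iff, hht']
    positivity

omit [Fintype ι] [P.IsCrystallographic] [P.IsReduced] in
lemma functional_eq_or (h : HalfClass n m k p) {F : V →ₗ[ℝ] ℝ}
    (hF : ∀ a ≤ n, F (ε a) = halfWeight m k a) {i : ι} (hi : i ∈ posRootsMult b m) :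
    F (P.root i) = b.height i / m ∨
      ∃ c d, d < c ∧ c ≤ p ∧ P.root i = halfVec ε m k c + halfVec ε m k d := by
  obtain ⟨hmk, hk, -, -, -⟩ := id h
  have hm := h.one_le_m
  have hd : (m : ℤ) ∣ b.height i := hi.1
  obtain ⟨a, c, hac, hc, h1 | h1⟩ := hR.pos_cases i hi.2
  · have hht := hR.height_of_root_eq_sub (a := c) (c := a) (by simpa using hc) (by simp; omega)
      (by simpa using h1)
    left
    rw [hht] at hd ⊢
    rw [h1, map_sub, hF c hc, hF a (by omega), halfWeight_sub hd]
    push_cast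
    rfl
  · have hht := hR.height_of_root_eq_add hc (by omega) h1
    rw [hht] at hd ⊢
    rcases halfWeight_add hk hmk (by exact_mod_cast hd) with ⟨h2, h3⟩ | h2
    · right
      have h4 := Nat.mod_add_div a m
      have h5 := Nat.mod_add_div c m
      rw [h2, mul_comm] at h4
      rw [h3, mul_comm] at h5
      refine ⟨c / m, a / m, ?_, h.le_of_le_p (h5.trans_le hc), by
        rw [halfVec, halfVec, h4, h5, h1]⟩
      exact lt_of_mul_lt_mul_right (a := m) (by omega) (by omega)
    · left
      rw [h1, map_add, hF c hc, hF a (by omega), h2]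
      push_cast
      rfl

omit [Fintype ι] [P.IsCrystallographic] [P.IsReduced] in
lemma halfVec_add_injective (h : HalfClass n m k p) {c d c' d' : ℕ} (hdc : d < c) (hc : c ≤ p)
    (hdc' : d' < c') (hc' : c' ≤ p)
    (heq : halfVec ε m k c + halfVec ε m k d = halfVec ε m k c' + halfVec ε m k d') :
    c = c' ∧ d = d' := by
  -- The form with the vector of index x detects whether x occurs in the sum.
  have key : ∀ x ≤ p, ((x = c ∨ x = d) ↔ (x = c' ∨ x = d')) := by
    intro x hx
    have h1 := congrArg (g (halfVec ε m k x)) heq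
    rw [map_add, map_add, hR.form_halfVec h hx hc, hR.form_halfVec h hx (by omega),
      hR.form_halfVec h hx hc', hR.form_halfVec h hx (by omega)] at h1
    split_ifs at h1 <;> first | omega | norm_num at h1
  have h1 := key c hc
  have h2 := key d (by omega)
  have h3 := key c' hc'
  omega

lemma dimConst_eq (h : HalfClass n m k p) : dimConst b m = 2 ^ p := by
  classical
  obtain ⟨hmk, hk, -, -, -⟩ := id h
  have hm : (m : ℝ) ≠ 0 := by have := h.one_le_m; norm_cast; omega
  obtain ⟨F, hF⟩ := hR.exists_functional (halfWeight m k) (halfWeight_zero hk)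
  have hratio : ∀ i ∈ posRootsMult b m,
      P.root' i ((1 / m : ℝ) • halfSumCoroots (P := P) {i | b.IsPos i}) /
        P.root' i (halfSumCoroots (P := P) (posRootsMult b m)) =
      (b.height i / m) / F (P.root i) := by
    intro i hi
    rw [root'_halfSumCoroots (fun j hj => hR.functional_simpleRootsMult h hF hj) hi, map_smul,
      hR.root'_halfSumCoroots_isPos hi.2, smul_eq_mul]
    ring
  -- Pairs outside the triangle d < c ≤ p receive an arbitrary root, so that the choice `r` is a
  -- total function.
  have hr : ∀ z : Σ _ : ℕ, ℕ, ∃ i, z.2 < z.1 → z.1 ≤ p →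
      P.root i = halfVec ε m k z.1 + halfVec ε m k z.2 ∧ i ∈ posRootsMult b m ∧
        b.height i = ((z.1 + z.2 + 1) * m : ℕ) := by
    intro z
    by_cases hz : z.2 < z.1 ∧ z.1 ≤ p
    · obtain ⟨i, hi⟩ := hR.exists_half_root h hz.1 hz.2
      exact ⟨i, fun _ _ => hi⟩
    · obtain ⟨i, -⟩ := hR.exists_delta h
      exact ⟨i, fun h1 h2 => absurd ⟨h1, h2⟩ hz⟩
  choose r hr using hr
  rw [← prod_range_add_div, Finset.prod_sigma', dimConst]
  symm
  have hmem : ∀ z ∈ (Finset.range (p + 1)).sigma fun c => Finset.range c,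
      z.2 < z.1 ∧ z.1 ≤ p := by
    intro z hz
    simp only [Finset.mem_sigma, Finset.mem_range] at hz
    omega
  -- The product over the triangle is matched with the roots ε_{k+cm} + ε_{k+dm}; every other root
  -- of R⁺(m) contributes the factor 1.
  refine Finset.prod_of_injOn r ?_ ?_ ?_ ?_
  · intro z hz z' hz' heq
    obtain ⟨h1, h2⟩ := hmem z hz
    obtain ⟨h1', h2'⟩ := hmem z' hz'
    have h3 := (hr z h1 h2).1
    rw [heq, (hr z' h1' h2').1] at h3
    obtain ⟨h4, h5⟩ := hR.halfVec_add_injective h h1' h2' h1 h2 h3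
    exact Sigma.ext h4.symm (heq_of_eq h5.symm)
  · intro z hz
    obtain ⟨h1, h2⟩ := hmem z hz
    exact Finset.mem_coe.2 (Finset.mem_filter.2 ⟨Finset.mem_univ _, (hr z h1 h2).2.1⟩)
  · intro i hi hi'
    have hi := (Finset.mem_filter.1 hi).2
    rw [hratio i hi]
    rcases hR.functional_eq_or h hF hi with h1 | ⟨c, d, hdc, hc, h1⟩
    · have h2 : 0 < b.height i := hi.2
      have h3 : (b.height i : ℝ) ≠ 0 := by exact_mod_cast h2.ne'
      rw [h1, div_self (div_ne_zero h3 hm)]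
    · refine absurd ⟨⟨c, d⟩, ?_, ?_⟩ hi'
      · simp only [Finset.coe_sigma, Set.mem_sigma_iff, Finset.coe_range, Set.mem_Iio]
        omega
      · exact P.root.injective (((hr ⟨c, d⟩ hdc hc).1).trans h1.symm)
  · intro z hz
    obtain ⟨h1, h2⟩ := hmem z hz
    obtain ⟨h3, h4, h5⟩ := hr z h1 h2
    rw [hratio _ h4, h3, map_add, hF _ (h.le_of_le h2), hF _ (h.le_of_le (by omega)),
      halfWeight_add_mul hk hmk, halfWeight_add_mul hk hmk, h5]
    push_cast
    field_simp

end Realization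

end DimConst

end HeightSubsystem

/-! ### The three cases -/

theorem mainTheorem4 {ι V N : Type*} [Fintype ι] [AddCommGroup V] [Module ℝ V]
    [AddCommGroup N] [Module ℝ N]
    (P : RootPairing ι ℝ V N) [P.IsRootSystem] [P.IsCrystallographic] [P.IsReduced]
    (b : P.Base)
    -- `R` is of type `B_n` or `D_{n+1}`, with `n ≥ 3`
    (X : Family) (n : ℕ) (hn : 3 ≤ n)
    (e : Fin (X.rank n) ≃ b.support)
    (he : ∀ x y, b.cartanMatrix (e x) (e y) = X.BD n x y)
    (m q t k : ℕ) (hm : 1 ≤ m) (hmn : m ≤ n) (hqt : n = q * m + t) (ht : t < m) (hk : k = m / 2) :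
    -- (a)
    (m = 2 * k + 1 →
      IsLeviType b (rootsMult b m) ∧
      (∀ i, 1 ≤ i → i ≤ k → t = k + i →
        HasType P (rootsMult b m)
          (X.BD q ⊕ᴅ copies i (typeA (2 * q + 1)) ⊕ᴅ copies (k - i) (typeA (2 * q)))) ∧
      (t ≤ k →
        HasType P (rootsMult b m)
          (X.BD q ⊕ᴅ copies t (typeA (2 * q)) ⊕ᴅ copies (k - t) (typeA (2 * q - 1))))) ∧
    -- (b)
    (m = 2 * k → n = m + t → t < k →
      HasType P (rootsMult b m)
        (X.BD 1 ⊕ᴅ copies t (typeA 2) ⊕ᴅ copies (k - 1 - t) (typeA 1)) ∧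
      IsLeviType b (rootsMult b m)) ∧
    -- (c)
    (m = 2 * k → 3 * k ≤ n →
      ¬ IsLeviType b (rootsMult b m) ∧
      (∀ i, i < k → t = k + i →
        TableRow X n e m k q
          (X.BD q ⊕ᴅ copies (k - 1 - i) (typeA (2 * q)) ⊕ᴅ copies i (typeA (2 * q + 1)))) ∧
      (2 ≤ q → t < k →
        TableRow X n e m k (q - 1)
          (X.BD q ⊕ᴅ copies t (typeA (2 * q)) ⊕ᴅ copies (k - 1 - t) (typeA (2 * q - 1))))) := by
  have hR := realization X n e (by omega) he
  have hq : 1 ≤ q := by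
    rcases Nat.eq_zero_or_pos q with rfl | h
    · omega
    · exact h
  -- The index type of the matrix depends on the chain lengths and multiplicities, so equalities
  -- between these numbers are substituted once, for a predicate `Q` on matrices of any size.
  have hcast : ∀ {G H : ResidueGroup} {L₁ L₂ c₁ c₂ : ℕ} {Q : ∀ {κ : Type}, Matrix κ κ ℤ → Prop},
      G.l + G.p = L₁ → H.l + H.p = L₂ → G.c = c₁ → H.c = c₂ → Q (restMatrix X q G H) →
      Q (X.BD q ⊕ᴅ copies c₁ (typeA L₁) ⊕ᴅ copies c₂ (typeA L₂)) := by
    rintro G H L₁ L₂ c₁ c₂ Q rfl rfl rfl rfl h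
    exact h
  refine ⟨fun hmk => ?_, fun hmk hnt htk => ?_, fun hmk hkn => ?_⟩
  · have hodd : ∀ k', m = 2 * k' → n < 3 * k' := fun k' hk' => by omega
    refine ⟨hR.isLeviType_rootsMult hm hodd, fun i hi hik htk => ?_, fun htk => ?_⟩
    -- The cover is reversed because the longer chains A_{2q+1} come first in this case.
    · exact hcast (Q := HasType P (rootsMult b m)) (by simp only; omega) (by simp only; omega)
        (by simp only; omega) (by simp only; omega)
        (hR.hasType_rootsMult
          (residueCover_high (d := k) hqt ht (by omega) (by omega)).symm hm hq hqt ht hodd)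
    · exact hcast (Q := HasType P (rootsMult b m)) (by simp only; omega) (by simp only; omega)
        (by simp only) (by simp only)
        (hR.hasType_rootsMult
          (residueCover_low (d := k) hqt hq (by omega) (by omega)) hm hq hqt ht hodd)
  · have hn3 : ∀ k', m = 2 * k' → n < 3 * k' := fun k' hk' => by omega
    obtain rfl : q = 1 := by
      have h1 : q * m = 1 * m := by omega
      exact Nat.eq_of_mul_eq_mul_right hm h1
    refine ⟨?_, hR.isLeviType_rootsMult hm hn3⟩
    exact hcast (Q := HasType P (rootsMult b m)) (by simp only) (by simp only)
        (by simp only) (by simp only)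
        (hR.hasType_rootsMult
          (residueCover_low (d := k - 1) hqt hq (by omega) (by omega)) hm hq hqt ht hn3)
  · refine ⟨hmk ▸ hR.not_isLeviType_rootsMult (by omega) hkn, fun i hi htk => ?_,
      fun hq2 htk => ?_⟩
    -- As t ≥ k, the class of k reaches k + qm ≤ n, so p = q.
    · have hH : HalfClass n m k q :=
        ⟨hmk, by omega, hq, by omega, by rw [add_mul]; omega⟩
      exact hcast (Q := TableRow X n e m k q) (by simp only; omega) (by simp only; omega)
        (by simp only; omega) (by simp only; omega)
        (hR.tableRow_of_dimConst hH
          (residueCover_high (d := k - 1) hqt ht (by omega) (by omega)) hq hqt ht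
          (hR.dimConst_eq hH))
    -- As t < k, the number k + qm exceeds n, so p = q - 1.
    · have hq1 : q - 1 + 1 = q := by omega
      have h1 : q * m = (q - 1) * m + m := by
        nth_rw 1 [← hq1]
        ring
      have hH : HalfClass n m k (q - 1) :=
        ⟨hmk, by omega, by omega, by omega, by rw [hq1]; omega⟩
      exact hcast (Q := TableRow X n e m k (q - 1)) (by simp only; omega) (by simp only; omega)
        (by simp only) (by simp only)
        (hR.tableRow_of_dimConst hH
          (residueCover_low (d := k - 1) hqt hq (by omega) (by omega)) hq hqt ht
          (hR.dimConst_eq hH))
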